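/- Let $d,n\ge 1$, let $L_1,\dots,L_n>0$ and $\alpha_1,\dots,\alpha_n\in[0,1]$, and let $f=\sum_{j=1}^n f_j$, where each $f_j:\mathbb R^d\to\mathbb R$ is locally Lipschitz with a subgradient $f_j'$ satisfying $$\|f_j'(u)-f_j'(v)\|\le L_j\|u-v\|^{\alpha_j}\qquad\text{for all }u,v\in\mathbb R^d .$$ (Here "$f_j'$ is a subgradient of $f_j$" means that $f_j'(x)$ is a Clarke subgradient of $f_j$ at every $x$ and is the gradient of $f_j$ at almost every $x$; for convex $f_j$ this is any selection of the convex subdifferential.) Put $f'=\sum_j f_j'$ and $$M_{L,d}=\Big(\sum_{j=1}^n L_j^{\frac1{\alpha_j+1}}\,d^{\frac{\alpha_j}{2(\alpha_j+1)}}\Big)^2 .$$ Let $\eta>0$, $y\in\mathbb R^d$, and let $x_y\in\mathbb R^d$ be a stationary point, $f'(x_y)+\frac1\eta(x_y-y)=0$, which is assumed to be given exactly. Put $g(x)=f(x)-\langle f'(x_y),x\rangle$. Consider the following approximate rejection sampler: repeat, with fresh independent randomness in each iteration, draw $x,z$ independently from $\mathcal N(x_y,\eta I)$ and $u$ uniformly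 from $[0,1]$, and set $\rho=\exp(g(z)-g(x))$, until $u\le\frac12\rho$; then return $x$. Each iteration queries $f$ at $z$ and at $x$. There is a universal constant $C$ (independent of $d,n,L_j,\alpha_j,f,\eta,\zeta,y,x_y$) such that, for every $\zeta>0$, if $$\eta\le\min\Big(\Big(49\,M_{L,d}\,\big(2+\log(1+192\,n\,(d^2+2d)/\zeta^4)\big)\Big)^{-1},\,1\Big),$$ then the sampler terminates almost surely, and the distribution of the returned point is within Wasserstein-2 distance $\zeta$ of the probability distribution with density proportional to $\exp\!\big(-f(x)-\frac1{2\eta}\|x-y\|^2\big)$. If moreover $\zeta<2\sqrt{2d}$, then the expected total number of queries to $f$ is at most $C$. -/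

import Mathlib

open MeasureTheory Filter Topology
open scoped ENNReal NNReal RealInnerProductSpace

namespace RGO

noncomputable section

/-- The Euclidean space `ℝ^d`. -/
abbrev E (d : ℕ) : Type := EuclideanSpace ℝ (Fin d)

/-! ### Subgradients of (possibly nonconvex) locally Lipschitz functions -/

/-- Clarke's generalized directional derivative
`f°(x; v) = limsup_{w → x, t ↓ 0} (f (w + t v) - f w) / t`. -/
def clarkeDeriv {d : ℕ} (f : E d → ℝ) (x v : E d) : EReal :=
  limsup (fun p : E d × ℝ => (((f (p.1 + p.2 • v) - f p.1) / p.2 : ℝ) : EReal))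
    (𝓝 x ×ˢ 𝓝[>] (0 : ℝ))

/-- The Clarke subdifferential of `f` at `x` (for convex `f`, the convex subdifferential). -/
def clarkeSubdifferential {d : ℕ} (f : E d → ℝ) (x : E d) : Set (E d) :=
  {ξ | ∀ v : E d, ((⟪ξ, v⟫ : ℝ) : EReal) ≤ clarkeDeriv f x v}

/-- `f'` is a subgradient of the locally Lipschitz function `f`: the vector `f' x` is a Clarke
subgradient at every point `x`, and it is the gradient of `f` at almost every point. -/
structure IsSubgradient {d : ℕ} (f : E d → ℝ) (f' : E d → E d) : Prop where
  locallyLipschitz : LocallyLipschitz f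
  mem_subdifferential : ∀ x, f' x ∈ clarkeSubdifferential f x
  ae_hasGradientAt : ∀ᵐ x : E d, HasGradientAt f (f' x) x

/-- `f'` is a subgradient of `f` and `‖f' u - f' v‖ ≤ L ‖u - v‖ ^ α` for all `u`, `v`. -/
structure SemiSmooth {d : ℕ} (f : E d → ℝ) (f' : E d → E d) (L α : ℝ) : Prop where
  isSubgradient : IsSubgradient f f'
  holder : ∀ u v : E d, ‖f' u - f' v‖ ≤ L * ‖u - v‖ ^ α

/-- `M_{L,d} = (∑ⱼ Lⱼ ^ (1 / (αⱼ + 1)) * d ^ (αⱼ / (2 (αⱼ + 1)))) ^ 2`. -/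
def compositeConst {n : ℕ} (L α : Fin n → ℝ) (d : ℕ) : ℝ :=
  (∑ j, L j ^ (1 / (α j + 1)) * (d : ℝ) ^ (α j / (2 * (α j + 1)))) ^ 2

/-! ### The target distribution and the Wasserstein distance -/

/-- The probability distribution on `ℝ^d` with density proportional to
`exp (-f x - ‖x - y‖ ^ 2 / (2 η))`. -/
def target {d : ℕ} (f : E d → ℝ) (η : ℝ) (y : E d) : Measure (E d) :=
  volume.tilted (fun x => -f x - 1 / (2 * η) * ‖x - y‖ ^ 2)

/-- `γ` is a coupling of `μ` and `ν`. -/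
structure IsCoupling {d : ℕ} (μ ν : Measure (E d)) (γ : Measure (E d × E d)) : Prop where
  isProbabilityMeasure : IsProbabilityMeasure γ
  map_fst : γ.map Prod.fst = μ
  map_snd : γ.map Prod.snd = ν

/-- The Wasserstein-2 distance. -/
def wasserstein2 {d : ℕ} (μ ν : Measure (E d)) : ℝ≥0∞ :=
  (⨅ (γ : Measure (E d × E d)) (_ : IsCoupling μ ν γ), ∫⁻ p, edist p.1 p.2 ^ 2 ∂γ) ^ (1 / 2 : ℝ)

/-! ### Programs with access to an evaluation oracle -/

/-- A deterministic program that returns an element of `β` and may, adaptively, query the value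
of a real function at points of `X`. -/
inductive OracleProgram (X β : Type) : Type where
  | done (b : β) : OracleProgram X β
  | query (x : X) (next : ℝ → OracleProgram X β) : OracleProgram X β

/-- The value returned when queries are answered by `f`. -/
def OracleProgram.run {X β : Type} (f : X → ℝ) : OracleProgram X β → β
  | .done b => b
  | .query x next => (next (f x)).run f

/-- The number of queries made when queries are answered by `f`. -/
def OracleProgram.queries {X β : Type} (f : X → ℝ) : OracleProgram X β → ℕ
  | .done _ => 0
  | .query x next => (next (f x)).queries f + 1

/-! ### Approximate rejection sampling -/

/-- The randomness `(x, z, u)` drawn in one iteration of the loop. -/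
abbrev Draw (d : ℕ) : Type := E d × E d × unitInterval

/-- The proposal `φ`, with density proportional to `exp (-‖x - c‖ ^ 2 / (2 η))`. -/
def proposal {d : ℕ} (η : ℝ) (c : E d) : Measure (E d) :=
  volume.tilted (fun x => -(1 / (2 * η) * ‖x - c‖ ^ 2))

/-- The acceptance test of one iteration, where `v` is the subgradient at the stationary point:
with `g x = f x - ⟪v, x⟫` and `ρ = exp (g z - g x)`, accept iff `u ≤ ρ / 2`.
It queries `f` at `z` and at `x`. -/
def acceptanceTest {d : ℕ} (v : E d) (w : Draw d) : OracleProgram (E d) Prop :=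
  .query w.2.1 fun fz => .query w.1 fun fx =>
    .done ((w.2.2 : ℝ) ≤ 1 / 2 * Real.exp ((fz - ⟪v, w.2.1⟫) - (fx - ⟪v, w.1⟫)))

/-- The `k`-th iteration of the loop accepts. -/
def Accepts {d : ℕ} (f : E d → ℝ) (v : E d) (ω : ℕ → Draw d) (k : ℕ) : Prop :=
  (acceptanceTest v (ω k)).run f

/-- The loop terminates. -/
def Terminates {d : ℕ} (f : E d → ℝ) (v : E d) (ω : ℕ → Draw d) : Prop :=
  ∃ k, Accepts f v ω k

/-- The returned point: the `x` of the first iteration that accepts (a default value if the loop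
does not terminate). -/
def output {d : ℕ} (f : E d → ℝ) (v : E d) (ω : ℕ → Draw d) : E d :=
  (ω (sInf {k | Accepts f v ω k})).1

open Classical in
/-- The total number of queries to `f`: the sum of the queries of all iterations that are
executed, an iteration being executed iff no earlier one has accepted. -/
def totalQueries {d : ℕ} (f : E d → ℝ) (v : E d) (ω : ℕ → Draw d) : ℝ≥0∞ :=
  ∑' k, if ∀ i < k, ¬ Accepts f v ω i then
    (((acceptanceTest v (ω k)).queries f : ℕ) : ℝ≥0∞) else 0

/-- The law of the randomness: independent iterations, in each of which `x`, `z` are drawn from the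
proposal centred at `c` and `u` is uniform on `[0, 1]`, all independently. -/
def drawLaw {d : ℕ} (η : ℝ) (c : E d) : Measure (ℕ → Draw d) :=
  Measure.infinitePi fun _ : ℕ =>
    (proposal η c).prod ((proposal η c).prod (volume : Measure unitInterval))

/-- The distribution of the returned point. -/
def outputLaw {d : ℕ} (f : E d → ℝ) (v : E d) (η : ℝ) (c : E d) : Measure (E d) :=
  (drawLaw η c).map (output f v)

/-- The expected number of queries to `f`. -/
def expectedQueries {d : ℕ} (f : E d → ℝ) (v : E d) (η : ℝ) (c : E d) : ℝ≥0∞ :=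
  ∫⁻ ω, totalQueries f v ω ∂(drawLaw η c)

end

end RGO

namespace RGO

section

open ProbabilityTheory

/-! Let `φ` be the proposal, `ρ = exp (g z - g x)`. Averaging `ρ` over `z` gives a constant times
`exp (-g x)`, so accepting with probability proportional to `ρ` would sample `φ` tilted by `-g`
exactly. By stationarity of the centre and completing the square, this is the target
(`target_eq_tilted_proposal`). The sampler uses `min 2 ρ` in place of `ρ`, and only the excess `(ρ -
2)₊` separates the two laws.

Swapping `x` and `z` inverts `ρ`, and `min 2 a + min 2 a⁻¹ ≥ 2`; hence an iteration accepts with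
probability at least `1/2`. This yields almost sure termination and at most 2 expected iterations,
that is, 4 queries.

For the distance, keep the common part of the two laws in place and couple the remainders
independently (`wasserstein2_add_le`). With `V` bounding the root of the fourth moment of `φ` and
`Y` the `L²` norm of the excess, the squared distance is at most `6 V Y`
(`wasserstein2_accepted_tilted_le`).

The excess is small because `g (z) - g (x)` concentrates: the Maurey–Pisier inequality
(`lintegral_exp_sub_le`) bounds its exponential moments by those of the squared gradient of `G w = g
(c + √η w)`. Subtracting `f' c` lets the Hölder conditions bound that square by `a (1 + a ‖w‖² /
d)`, where `a = η M`. The step size makes `a Λ ≤ 1/49` for `Λ = 2 + log (1 + K)`, which gives `Y = 2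
exp (-Λ)`. -/

/-! ### Gaussian integrals and exponential moments. -/

lemma integrable_exp_neg_mul_sq_norm {d : ℕ} {b : ℝ} (hb : 0 < b) :
    Integrable (fun x : E d => Real.exp (-b * ‖x‖ ^ 2)) := by
  refine Integrable.of_integral_ne_zero ?_
  rw [GaussianFourier.integral_rexp_neg_mul_sq_norm hb]
  positivity

lemma integral_exp_proposal {d : ℕ} {η : ℝ} (hη : 0 < η) (c : E d) :
    ∫ x : E d, Real.exp (-(1 / (2 * η) * ‖x - c‖ ^ 2)) = (2 * Real.pi * η) ^ (d / 2 : ℝ) := by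
  rw [integral_sub_right_eq_self (fun x : E d => Real.exp (-(1 / (2 * η) * ‖x‖ ^ 2))) c]
  have := GaussianFourier.integral_rexp_neg_mul_sq_norm (V := E d) (b := 1 / (2 * η)) (by positivity)
  simp only [neg_mul] at this
  rw [this]
  simp only [finrank_euclideanSpace, Fintype.card_fin]
  congr 1
  field_simp

lemma integrable_exp_proposal {d : ℕ} {η : ℝ} (hη : 0 < η) (c : E d) :
    Integrable (fun x : E d => Real.exp (-(1 / (2 * η) * ‖x - c‖ ^ 2))) := by
  refine Integrable.of_integral_ne_zero ?_
  rw [integral_exp_proposal hη]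
  positivity

lemma isProbabilityMeasure_proposal {d : ℕ} {η : ℝ} (hη : 0 < η) (c : E d) :
    IsProbabilityMeasure (proposal η c) :=
  isProbabilityMeasure_tilted (integrable_exp_proposal hη c)

/-- Both characteristic functions are computed from the complex Gaussian integral. The standard form
gives access to rotation invariance. -/
lemma proposal_eq_map {d : ℕ} {η : ℝ} (hη : 0 < η) (c : E d) :
    proposal η c = (stdGaussian (E d)).map (fun x => c + √η • x) := by
  have := isProbabilityMeasure_proposal hη c
  have : IsProbabilityMeasure ((stdGaussian (E d)).map (fun x => c + √η • x)) :=
    Measure.isProbabilityMeasure_map (by fun_prop)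
  refine Measure.ext_of_charFun (funext fun t => ?_)
  have hmap : (stdGaussian (E d)).map (fun x => c + √η • x)
      = ((stdGaussian (E d)).map (fun x => √η • x)).map (fun x => c + x) := by
    rw [Measure.map_map (by fun_prop) (by fun_prop)]
    rfl
  rw [hmap, charFun_map_const_add, charFun_map_smul, charFun_stdGaussian, charFun_apply, proposal,
    integral_tilted, integral_exp_proposal hη]
  have h := GaussianFourier.integral_cexp_neg_mul_sq_norm_add (V := E d) (b := ((1 / (2 * η) : ℝ) : ℂ))
    (by rw [Complex.ofReal_re]; positivity) Complex.I t
  have hbase : (Real.pi : ℂ) / ((1 / (2 * η) : ℝ) : ℂ) = ((2 * Real.pi * η : ℝ) : ℂ) := by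
    push_cast
    field_simp
  have hpow : ((2 * Real.pi * η : ℝ) : ℂ) ^ ((d : ℂ) / 2)
      = (((2 * Real.pi * η) ^ (d / 2 : ℝ) : ℝ) : ℂ) := by
    rw [Complex.ofReal_cpow (by positivity)]
    push_cast
    rfl
  have hne : (((2 * Real.pi * η) ^ (d / 2 : ℝ) : ℝ) : ℂ) ≠ 0 := by
    rw [Complex.ofReal_ne_zero]
    positivity
  rw [finrank_euclideanSpace, Fintype.card_fin, hbase, hpow,
    ← integral_sub_right_eq_self _ c] at h
  calc ∫ x : E d, (Real.exp (-(1 / (2 * η) * ‖x - c‖ ^ 2)) / (2 * Real.pi * η) ^ (d / 2 : ℝ)) •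
        Complex.exp (⟪x, t⟫ * Complex.I)
      = ∫ x : E d, (Complex.exp (⟪c, t⟫ * Complex.I) /
          (((2 * Real.pi * η) ^ (d / 2 : ℝ) : ℝ) : ℂ)) *
        Complex.exp (-((1 / (2 * η) : ℝ) : ℂ) * ‖x - c‖ ^ 2 + Complex.I * ⟪t, x - c⟫) := by
        refine integral_congr_ae (ae_of_all _ fun x => ?_)
        have hx : ⟪x, t⟫ = ⟪c, t⟫ + ⟪t, x - c⟫ := by
          rw [inner_sub_right, real_inner_comm t x, real_inner_comm t c]
          ring
        simp only [hx, Complex.real_smul]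
        push_cast
        rw [div_mul_eq_mul_div (Complex.exp _), div_mul_eq_mul_div (Complex.exp _),
          ← Complex.exp_add, ← Complex.exp_add]
        congr 2
        ring
    _ = _ := by
        rw [integral_const_mul, h]
        field_simp
        congr 1
        rw [norm_smul, Real.norm_of_nonneg (Real.sqrt_nonneg _),
          ← Complex.ofReal_pow (√η * ‖t‖), mul_pow, Real.sq_sqrt hη.le, Complex.I_sq]
        push_cast
        field_simp
        ring

lemma lintegral_stdGaussian {d : ℕ} (h : E d → ℝ≥0∞) :
    ∫⁻ x, h x ∂(stdGaussian (E d)) = ENNReal.ofReal ((2 * Real.pi) ^ (d / 2 : ℝ))⁻¹ *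
      ∫⁻ x, ENNReal.ofReal (Real.exp (-(1 / 2 * ‖x‖ ^ 2))) * h x := by
  have h1 : stdGaussian (E d) = proposal 1 0 := by
    rw [proposal_eq_map one_pos]
    simp
  rw [h1, proposal, lintegral_tilted, integral_exp_proposal one_pos,
    ← lintegral_const_mul' _ _ ENNReal.ofReal_ne_top]
  refine lintegral_congr fun x => ?_
  rw [← mul_assoc, ← ENNReal.ofReal_mul (by positivity), div_eq_inv_mul]
  simp

lemma lintegral_exp_inner_stdGaussian {d : ℕ} (v : E d) :
    ∫⁻ w, ENNReal.ofReal (Real.exp ⟪v, w⟫) ∂(stdGaussian (E d))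
      = ENNReal.ofReal (Real.exp (‖v‖ ^ 2 / 2)) := by
  have h1 := lintegral_stdGaussian (d := d) (fun _ => 1)
  simp only [mul_one, lintegral_one, measure_univ] at h1
  rw [lintegral_stdGaussian]
  have h2 : ∀ x : E d, ENNReal.ofReal (Real.exp (-(1 / 2 * ‖x‖ ^ 2)))
      * ENNReal.ofReal (Real.exp ⟪v, x⟫) = ENNReal.ofReal (Real.exp (‖v‖ ^ 2 / 2)) *
        ENNReal.ofReal (Real.exp (-(1 / 2 * ‖x - v‖ ^ 2))) := by
    intro x
    rw [← ENNReal.ofReal_mul (by positivity), ← ENNReal.ofReal_mul (by positivity),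
      ← Real.exp_add, ← Real.exp_add, norm_sub_sq_real, real_inner_comm]
    congr 2
    ring
  simp_rw [h2]
  rw [lintegral_const_mul' _ _ ENNReal.ofReal_ne_top,
    lintegral_sub_right_eq_self (fun x : E d => ENNReal.ofReal (Real.exp (-(1 / 2 * ‖x‖ ^ 2)))) v,
    mul_left_comm, ← h1, mul_one]

/-- The integral equals `(1 - 2q) ^ (-d/2)` with `q = θ / d`, and `1 / (1 - 2q) ≤ 1 + 4q ≤ exp (4q)`
for `0 ≤ q ≤ 1/4`. The bound is free of the dimension. -/
lemma lintegral_exp_norm_sq_stdGaussian_le {d : ℕ} (hd : 0 < d) {θ : ℝ} (h0 : 0 ≤ θ)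
    (h1 : θ ≤ 1 / 4) :
    ∫⁻ w, ENNReal.ofReal (Real.exp (θ / d * ‖w‖ ^ 2)) ∂(stdGaussian (E d))
      ≤ ENNReal.ofReal (Real.exp (2 * θ)) := by
  have hd1 : (1 : ℝ) ≤ d := by exact_mod_cast hd
  have hd0 : (0 : ℝ) < d := by linarith
  have hq : θ / d ≤ 1 / 4 := (div_le_self h0 hd1).trans h1
  have hb : 0 < 1 / 2 - θ / d := by linarith
  rw [lintegral_stdGaussian]
  have h2 : ∀ x : E d, ENNReal.ofReal (Real.exp (-(1 / 2 * ‖x‖ ^ 2)))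
      * ENNReal.ofReal (Real.exp (θ / d * ‖x‖ ^ 2))
        = ENNReal.ofReal (Real.exp (-(1 / 2 - θ / d) * ‖x‖ ^ 2)) := by
    intro x
    rw [← ENNReal.ofReal_mul (by positivity), ← Real.exp_add]
    congr 2
    ring
  simp_rw [h2]
  rw [← ofReal_integral_eq_lintegral_ofReal (integrable_exp_neg_mul_sq_norm hb)
      (ae_of_all _ fun _ => (Real.exp_pos _).le),
    GaussianFourier.integral_rexp_neg_mul_sq_norm hb, ← ENNReal.ofReal_mul (by positivity),
    finrank_euclideanSpace, Fintype.card_fin, inv_mul_eq_div, ← Real.div_rpow (by positivity)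
      (by positivity)]
  refine ENNReal.ofReal_le_ofReal ?_
  have hu : Real.pi / (1 / 2 - θ / d) / (2 * Real.pi) ≤ Real.exp (4 * (θ / d)) := by
    have : Real.pi / (1 / 2 - θ / d) / (2 * Real.pi) = (1 - 2 * (θ / d))⁻¹ := by
      field_simp
    rw [this]
    have hpos : 0 < 1 - 2 * (θ / d) := by linarith
    refine le_trans ?_ (Real.add_one_le_exp _)
    rw [inv_le_iff_one_le_mul₀ hpos]
    have : 0 ≤ θ / d := by positivity
    nlinarith
  calc (Real.pi / (1 / 2 - θ / d) / (2 * Real.pi)) ^ (d / 2 : ℝ)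
      ≤ Real.exp (4 * (θ / d)) ^ (d / 2 : ℝ) := by gcongr
    _ = Real.exp (2 * θ) := by
      rw [← Real.exp_mul]
      congr 1
      field_simp
      ring

lemma map_rotation_stdGaussian {d : ℕ} (θ : ℝ) :
    ((stdGaussian (E d)).prod (stdGaussian (E d))).map (ContinuousLinearMap.rotation θ)
      = (stdGaussian (E d)).prod (stdGaussian (E d)) :=
  IsGaussian.map_rotation_eq_self (by simp) θ

/-! ### The Maurey–Pisier inequality. -/

lemma measurable_gradient {d : ℕ} (G : E d → ℝ) : Measurable (gradient G) :=
  (InnerProductSpace.toDual ℝ (E d)).symm.continuous.measurable.comp (measurable_fderiv ℝ G)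

/-- A point on the quarter circle from `p.1` to `p.2`. -/
noncomputable def arc {d : ℕ} (p : E d × E d) (t : ℝ) : E d := Real.cos t • p.1 + Real.sin t • p.2

/-- The velocity of `arc`. -/
noncomputable def arcVelocity {d : ℕ} (p : E d × E d) (t : ℝ) : E d := -Real.sin t • p.1 + Real.cos t • p.2

lemma hasDerivAt_arc {d : ℕ} (p : E d × E d) (t : ℝ) :
    HasDerivAt (arc p) (arcVelocity p t) t :=
  ((Real.hasDerivAt_cos t).smul_const p.1).add ((Real.hasDerivAt_sin t).smul_const p.2)

lemma continuous_arc {d : ℕ} : Continuous fun q : (E d × E d) × ℝ => arc q.1 q.2 := by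
  unfold arc
  fun_prop

lemma continuous_arcVelocity {d : ℕ} :
    Continuous fun q : (E d × E d) × ℝ => arcVelocity q.1 q.2 := by
  unfold arcVelocity
  fun_prop

lemma locallyLipschitz_arc {d : ℕ} (p : E d × E d) : LocallyLipschitz (arc p) := by
  refine ContDiff.locallyLipschitz (𝕂 := ℝ) ?_
  unfold arc
  fun_prop

/-- Along the compact arc `G` is Lipschitz, hence absolutely continuous, so the fundamental theorem
of calculus needs no smoothness. -/
lemma integral_deriv_comp_arc {d : ℕ} {G : E d → ℝ} (hG : LocallyLipschitz G) (p : E d × E d) :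
    IntervalIntegrable (deriv (G ∘ arc p)) volume 0 (Real.pi / 2) ∧
    ∫ t in (0 : ℝ)..(Real.pi / 2), deriv (G ∘ arc p) t = G p.2 - G p.1 := by
  obtain ⟨K, hK⟩ := (hG.comp (locallyLipschitz_arc p)).locallyLipschitzOn
    |>.exists_lipschitzOnWith_of_compact (isCompact_uIcc (a := (0 : ℝ)) (b := Real.pi / 2))
  have hac := hK.absolutelyContinuousOnInterval
  refine ⟨hac.intervalIntegrable_deriv, ?_⟩
  rw [hac.integral_deriv_eq_sub]
  simp [arc]

/-- Jensen's inequality; if `exp ∘ h` is not integrable, the right side is `∞`. -/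
lemma ofReal_exp_integral_le {Ω : Type*} [MeasurableSpace Ω] (μ : Measure Ω)
    [IsProbabilityMeasure μ] {h : Ω → ℝ} (hh : Integrable h μ) :
    ENNReal.ofReal (Real.exp (∫ t, h t ∂μ)) ≤ ∫⁻ t, ENNReal.ofReal (Real.exp (h t)) ∂μ := by
  by_cases hi : Integrable (fun t => Real.exp (h t)) μ
  · rw [← ofReal_integral_eq_lintegral_ofReal hi (ae_of_all _ fun _ => (Real.exp_pos _).le)]
    exact ENNReal.ofReal_le_ofReal (convexOn_exp.map_integral_le Real.continuous_exp.continuousOn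
      isClosed_univ (by simp) hh hi)
  · have : ∫⁻ t, ENNReal.ofReal (Real.exp (h t)) ∂μ = ∞ := by
      by_contra hne
      refine hi ⟨Real.continuous_exp.comp_aestronglyMeasurable hh.1, ?_⟩
      rw [hasFiniteIntegral_iff_ofReal (ae_of_all _ fun _ => (Real.exp_pos _).le)]
      exact lt_top_iff_ne_top.2 hne
    simp [this]

/-- The uniform distribution on `(0, π / 2]`. -/
noncomputable def uniformAngle : Measure ℝ :=
  ENNReal.ofReal (2 / Real.pi) • volume.restrict (Set.Ioc 0 (Real.pi / 2))

instance : IsProbabilityMeasure uniformAngle := by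
  constructor
  rw [uniformAngle, Measure.smul_apply, Measure.restrict_apply_univ, Real.volume_Ioc, smul_eq_mul,
    ← ENNReal.ofReal_mul (by positivity)]
  have : 2 / Real.pi * (Real.pi / 2 - 0) = 1 := by
    have := Real.pi_pos
    field_simp
    ring
  rw [this, ENNReal.ofReal_one]

lemma ofReal_exp_sub_le {d : ℕ} {G : E d → ℝ} (hG : LocallyLipschitz G) (s : ℝ) (p : E d × E d) :
    ENNReal.ofReal (Real.exp (s * (G p.2 - G p.1))) ≤
      ∫⁻ t, ENNReal.ofReal (Real.exp (s * (Real.pi / 2) * deriv (G ∘ arc p) t)) ∂uniformAngle := by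
  obtain ⟨hi, he⟩ := integral_deriv_comp_arc hG p
  have hpi := Real.pi_pos
  rw [intervalIntegrable_iff_integrableOn_Ioc_of_le (by positivity)] at hi
  have hi' : Integrable (fun t => s * (Real.pi / 2) * deriv (G ∘ arc p) t) uniformAngle :=
    (hi.smul_measure ENNReal.ofReal_ne_top).const_mul _
  refine le_trans (le_of_eq ?_) (ofReal_exp_integral_le uniformAngle hi')
  rw [integral_const_mul, uniformAngle, integral_smul_measure,
    ← intervalIntegral.integral_of_le (by positivity), he, ENNReal.toReal_ofReal (by positivity),
    smul_eq_mul]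
  congr 2
  field_simp

/-- For fixed `t` the point `arc p t` is standard Gaussian by rotation invariance, so it almost
surely avoids the bad set of `G`; Fubini exchanges the order of the quantifiers over `p` and `t`. -/
lemma deriv_comp_arc_ae {d : ℕ} {G : E d → ℝ}
    (hG : ∀ᵐ x ∂(stdGaussian (E d)), DifferentiableAt ℝ G x) :
    ∀ᵐ p ∂((stdGaussian (E d)).prod (stdGaussian (E d))), ∀ᵐ t ∂uniformAngle,
      deriv (G ∘ arc p) t = ⟪gradient G (arc p t), arcVelocity p t⟫ := by
  have hmeas : MeasurableSet {x | DifferentiableAt ℝ G x} := measurableSet_of_differentiableAt ℝ G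
  have key : ∀ᵐ p ∂((stdGaussian (E d)).prod (stdGaussian (E d))), ∀ᵐ t ∂uniformAngle,
      DifferentiableAt ℝ G (arc p t) := by
    rw [Measure.ae_ae_comm (p := fun p t => DifferentiableAt ℝ G (arc p t))
      (continuous_arc.measurable hmeas)]
    refine ae_of_all _ fun t => ?_
    have h1 : ∀ᵐ q ∂((stdGaussian (E d)).prod (stdGaussian (E d))),
        DifferentiableAt ℝ G q.1 :=
      Measure.quasiMeasurePreserving_fst.ae hG
    rw [← map_rotation_stdGaussian t] at h1
    exact ae_of_ae_map (f := ContinuousLinearMap.rotation t) (by fun_prop) h1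
  filter_upwards [key] with p hp
  filter_upwards [hp] with t ht
  have := (ht.hasGradientAt.hasFDerivAt.comp_hasDerivAt t (hasDerivAt_arc p t)).deriv
  rw [this]
  simp

/-- **Maurey–Pisier inequality**. -/
theorem lintegral_exp_sub_le {d : ℕ} {G : E d → ℝ} (hG : LocallyLipschitz G)
    (hdiff : ∀ᵐ x ∂(stdGaussian (E d)), DifferentiableAt ℝ G x) (s : ℝ) :
    ∫⁻ p, ENNReal.ofReal (Real.exp (s * (G p.2 - G p.1)))
        ∂((stdGaussian (E d)).prod (stdGaussian (E d))) ≤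
      ∫⁻ x, ENNReal.ofReal (Real.exp (s ^ 2 * Real.pi ^ 2 / 8 * ‖gradient G x‖ ^ 2))
        ∂(stdGaussian (E d)) := by
  have hF : Measurable fun q : E d × E d =>
      ENNReal.ofReal (Real.exp (s * (Real.pi / 2) * ⟪gradient G q.1, q.2⟫)) := by
    have := measurable_gradient G
    fun_prop
  have hR : Measurable fun q : (E d × E d) × ℝ => (arc q.1 q.2, arcVelocity q.1 q.2) :=
    (continuous_arc.prodMk continuous_arcVelocity).measurable
  calc _ ≤ ∫⁻ p, ∫⁻ t, ENNReal.ofReal (Real.exp (s * (Real.pi / 2) * deriv (G ∘ arc p) t))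
        ∂uniformAngle ∂((stdGaussian (E d)).prod (stdGaussian (E d))) :=
        lintegral_mono fun p => ofReal_exp_sub_le hG s p
    _ = ∫⁻ p, ∫⁻ t, ENNReal.ofReal (Real.exp (s * (Real.pi / 2) *
          ⟪gradient G (arc p t), arcVelocity p t⟫))
        ∂uniformAngle ∂((stdGaussian (E d)).prod (stdGaussian (E d))) := by
        refine lintegral_congr_ae ?_
        filter_upwards [deriv_comp_arc_ae hdiff] with p hp
        refine lintegral_congr_ae ?_
        filter_upwards [hp] with t ht
        rw [ht]
    _ = ∫⁻ t, ∫⁻ p, ENNReal.ofReal (Real.exp (s * (Real.pi / 2) *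
          ⟪gradient G (arc p t), arcVelocity p t⟫))
        ∂((stdGaussian (E d)).prod (stdGaussian (E d))) ∂uniformAngle :=
        lintegral_lintegral_swap (hF.comp hR).aemeasurable
    _ = ∫⁻ _, ∫⁻ q, ENNReal.ofReal (Real.exp (s * (Real.pi / 2) * ⟪gradient G q.1, q.2⟫))
        ∂((stdGaussian (E d)).prod (stdGaussian (E d))) ∂uniformAngle := by
        -- Position and velocity on the arc are a rotation of `p` by `t`, so for each `t` they are
        -- again independent standard Gaussians. The velocity can then be integrated out with the
        -- Gaussian moment generating function.
        refine lintegral_congr fun t => ?_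
        conv_rhs => rw [← map_rotation_stdGaussian t, lintegral_map hF (by fun_prop)]
        rfl
    _ = ∫⁻ x, ∫⁻ w, ENNReal.ofReal (Real.exp (s * (Real.pi / 2) * ⟪gradient G x, w⟫))
        ∂(stdGaussian (E d)) ∂(stdGaussian (E d)) := by
        rw [lintegral_const, measure_univ, mul_one, lintegral_prod _ hF.aemeasurable]
    _ = _ := by
        refine lintegral_congr fun x => ?_
        simp_rw [← real_inner_smul_left]
        rw [lintegral_exp_inner_stdGaussian, norm_smul, mul_pow, Real.norm_eq_abs, sq_abs]
        congr 2
        ring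

/-! ### First hitting of a set by an i.i.d. sequence. -/

section FirstHit

variable {X : Type*} [MeasurableSpace X] (ν : Measure X) [IsProbabilityMeasure ν] {A : Set X}

lemma infinitePi_forall_lt_notMem_and_mem (hA : MeasurableSet A) {B : Set X}
    (hB : MeasurableSet B) (k : ℕ) :
    Measure.infinitePi (fun _ : ℕ => ν) {ω | (∀ i < k, ω i ∉ A) ∧ ω k ∈ B}
      = (1 - ν A) ^ k * ν B := by
  have hset : {ω : ℕ → X | (∀ i < k, ω i ∉ A) ∧ ω k ∈ B}
      = Set.pi (Finset.range (k + 1)) (fun i => if i = k then B else Aᶜ) := by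
    ext ω
    simp only [Set.mem_ofPred_eq, Set.mem_pi, Finset.coe_range, Set.mem_Iio]
    constructor
    · rintro ⟨h1, h2⟩ i hi
      split_ifs with h
      · exact h ▸ h2
      · exact h1 i (by omega)
    · intro h
      refine ⟨fun i hi => ?_, ?_⟩
      · have := h i (by omega)
        rwa [if_neg (by omega)] at this
      · simpa using h k (by omega)
  rw [hset, Measure.infinitePi_pi, Finset.prod_range_succ]
  · simp only [if_true]
    congr 1
    rw [← prob_compl_eq_one_sub hA, Finset.prod_congr rfl (g := fun _ => ν Aᶜ)]
    · simp
    · intro i hi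
      rw [if_neg (by simp at hi; omega)]
  · intro i _
    split_ifs
    exacts [hB, hA.compl]

lemma infinitePi_forall_lt_notMem (hA : MeasurableSet A) (k : ℕ) :
    Measure.infinitePi (fun _ : ℕ => ν) {ω | ∀ i < k, ω i ∉ A} = (1 - ν A) ^ k := by
  simpa using infinitePi_forall_lt_notMem_and_mem ν hA MeasurableSet.univ k

lemma tsum_infinitePi_forall_lt_notMem (hA : MeasurableSet A) :
    ∑' k, Measure.infinitePi (fun _ : ℕ => ν) {ω | ∀ i < k, ω i ∉ A} = (ν A)⁻¹ := by
  simp_rw [infinitePi_forall_lt_notMem ν hA]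
  rw [ENNReal.tsum_geometric, ENNReal.sub_sub_cancel ENNReal.one_ne_top prob_le_one]

lemma ae_infinitePi_exists_mem (hA : MeasurableSet A) (h0 : ν A ≠ 0) :
    ∀ᵐ ω ∂(Measure.infinitePi (fun _ : ℕ => ν)), ∃ k, ω k ∈ A := by
  have h : ∀ k, Measure.infinitePi (fun _ : ℕ => ν) {ω | ¬ ∃ k, ω k ∈ A} ≤ (1 - ν A) ^ k := by
    intro k
    rw [← infinitePi_forall_lt_notMem ν hA]
    exact measure_mono fun ω hω i _ hi => hω ⟨i, hi⟩
  have hlt : 1 - ν A < 1 := ENNReal.sub_lt_self ENNReal.one_ne_top one_ne_zero h0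
  exact le_antisymm (ge_of_tendsto' (ENNReal.tendsto_pow_atTop_nhds_zero_of_lt_one hlt) h) zero_le

lemma measurable_sInf_mem (hA : MeasurableSet A) :
    Measurable fun ω : ℕ → X => sInf {k | ω k ∈ A} := by
  refine measurable_of_Iic fun n => ?_
  -- The second set appears because `sInf ∅ = 0`: sequences that never hit lie in every preimage.
  have : (fun ω : ℕ → X => sInf {k | ω k ∈ A}) ⁻¹' Set.Iic n
      = {ω | ∃ k ≤ n, ω k ∈ A} ∪ {ω | ∀ k, ω k ∉ A} := by
    ext ω
    simp only [Set.mem_preimage, Set.mem_Iic, Set.mem_union, Set.mem_ofPred_eq]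
    constructor
    · intro h
      by_cases hne : {k | ω k ∈ A}.Nonempty
      · exact Or.inl ⟨_, h, Nat.sInf_mem hne⟩
      · exact Or.inr fun k hk => hne ⟨k, hk⟩
    · rintro (⟨k, hk, hkA⟩ | h)
      · exact (Nat.sInf_le hkA).trans hk
      · have : {k | ω k ∈ A} = ∅ := Set.eq_empty_of_forall_notMem h
        simp [this]
  rw [this]
  have hk : ∀ k, MeasurableSet {ω : ℕ → X | ω k ∈ A} := fun k => measurable_pi_apply k hA
  refine MeasurableSet.union ?_ ?_
  · have : {ω : ℕ → X | ∃ k ≤ n, ω k ∈ A} = ⋃ k ∈ Set.Iic n, {ω | ω k ∈ A} := by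
      ext; simp
    rw [this]
    exact MeasurableSet.biUnion (Set.to_countable _) fun k _ => hk k
  · rw [Set.ofPred_forall]
    exact MeasurableSet.iInter fun k => (hk k).compl

lemma measurable_firstHit (hA : MeasurableSet A) :
    Measurable fun ω : ℕ → X => ω (sInf {k | ω k ∈ A}) := by
  have : Measurable fun q : (ℕ → X) × ℕ => q.1 q.2 :=
    measurable_from_prod_countable_left fun n => measurable_pi_apply n
  exact this.comp (measurable_id.prodMk (measurable_sInf_mem hA))

/-- Splitting by the hitting time `k` gives the geometric series of `(1 - ν A) ^ k * ν (B ∩ A)`. -/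
lemma map_firstHit_infinitePi (hA : MeasurableSet A) (h0 : ν A ≠ 0) :
    (Measure.infinitePi (fun _ : ℕ => ν)).map (fun ω => ω (sInf {k | ω k ∈ A}))
      = (ν A)⁻¹ • ν.restrict A := by
  ext B hB
  rw [Measure.map_apply (measurable_firstHit hA) hB, Measure.smul_apply,
    Measure.restrict_apply hB, smul_eq_mul]
  set S : ℕ → Set (ℕ → X) := fun k => {ω | (∀ i < k, ω i ∉ A) ∧ ω k ∈ B ∩ A}
  have hS : ∀ k, MeasurableSet (S k) := by
    intro k
    have : S k = (⋂ i ∈ Set.Iio k, {ω | ω i ∈ A}ᶜ) ∩ {ω | ω k ∈ B ∩ A} := by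
      ext; simp [S]
    rw [this]
    exact (MeasurableSet.biInter (Set.to_countable _) fun i _ =>
      (measurable_pi_apply i hA).compl).inter (measurable_pi_apply k (hB.inter hA))
  have hdisj : Pairwise (Function.onFun Disjoint S) := by
    intro k l hkl
    rw [Function.onFun, Set.disjoint_left]
    rintro ω ⟨h1, h2⟩ ⟨h3, h4⟩
    rcases lt_or_gt_of_ne hkl with h | h
    · exact h3 k h h2.2
    · exact h1 l h h4.2
  have hae : (fun ω : ℕ → X => ω (sInf {k | ω k ∈ A})) ⁻¹' B
      =ᵐ[Measure.infinitePi (fun _ : ℕ => ν)] ⋃ k, S k := by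
    filter_upwards [ae_infinitePi_exists_mem ν hA h0] with ω hω
    refine propext ?_
    change ω (sInf {k | ω k ∈ A}) ∈ B ↔ ω ∈ ⋃ k, S k
    have hmem : ω (sInf {k | ω k ∈ A}) ∈ A := Nat.sInf_mem (s := {k | ω k ∈ A}) hω
    have hlt : ∀ i < sInf {k | ω k ∈ A}, ω i ∉ A := fun i hi => Nat.notMem_of_lt_sInf hi
    rw [Set.mem_iUnion]
    constructor
    · exact fun h => ⟨_, hlt, h, hmem⟩
    · rintro ⟨k, h1, h2, h3⟩
      have : sInf {k | ω k ∈ A} = k := by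
        refine le_antisymm (Nat.sInf_le h3) ?_
        by_contra! hk
        exact h1 _ hk hmem
      rwa [this]
  rw [measure_congr hae, measure_iUnion hdisj hS]
  simp_rw [S, infinitePi_forall_lt_notMem_and_mem ν hA (hB.inter hA)]
  rw [ENNReal.tsum_mul_right, ENNReal.tsum_geometric,
    ENNReal.sub_sub_cancel ENNReal.one_ne_top prob_le_one]

end FirstHit

/-! ### Coupling two measures with a common part. -/

lemma edist_sq_le {X : Type*} [PseudoEMetricSpace X] (x z c : X) :
    edist x z ^ 2 ≤ 2 * (edist x c ^ 2 + edist z c ^ 2) := by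
  have h := ENNReal.rpow_add_le_mul_rpow_add_rpow (edist x c) (edist z c) (p := 2) (by norm_num)
  norm_num at h
  refine le_trans ?_ h
  gcongr
  rw [edist_comm z c]
  exact edist_triangle x c z

/-- Couple two probability measures by keeping a common part in place and coupling the remainders
independently. -/
lemma wasserstein2_add_le {d : ℕ} (m μ ν : Measure (E d)) [IsProbabilityMeasure (m + μ)]
    [IsProbabilityMeasure (m + ν)] (c : E d) :
    wasserstein2 (m + μ) (m + ν) ≤
      (2 * (∫⁻ x, edist x c ^ 2 ∂μ + ∫⁻ x, edist x c ^ 2 ∂ν)) ^ (1 / 2 : ℝ) := by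
  have hm : IsFiniteMeasure m := isFiniteMeasure_of_le (m + μ) (Measure.le_add_right le_rfl)
  have hμ : IsFiniteMeasure μ := isFiniteMeasure_of_le (m + μ) (Measure.le_add_left le_rfl)
  have hν : IsFiniteMeasure ν := isFiniteMeasure_of_le (m + ν) (Measure.le_add_left le_rfl)
  have hmass : μ Set.univ = ν Set.univ := by
    have h1 : m Set.univ + μ Set.univ = 1 := measure_univ (μ := m + μ)
    have h2 : m Set.univ + ν Set.univ = 1 := measure_univ (μ := m + ν)
    exact (ENNReal.add_right_inj (measure_ne_top m _)).1 (h1.trans h2.symm)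
  -- If the remainders have mass zero, the factor `(μ univ)⁻¹` is `∞`, but it multiplies the zero
  -- measure.
  have hcancel : ∀ κ : Measure (E d), κ Set.univ = μ Set.univ →
      (μ Set.univ)⁻¹ • (μ Set.univ • κ) = κ := by
    intro κ hκ
    rcases eq_or_ne (μ Set.univ) 0 with h0 | h0
    · rw [h0] at hκ ⊢
      rw [Measure.measure_univ_eq_zero.1 hκ]
      simp
    · rw [smul_smul, ENNReal.inv_mul_cancel h0 (measure_ne_top _ _), one_smul]
  set γ : Measure (E d × E d) := m.map (fun x => (x, x)) + (μ Set.univ)⁻¹ • μ.prod ν with hγ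
  have hdiag : Measurable fun x : E d => (x, x) := by fun_prop
  have hfst : γ.map Prod.fst = m + μ := by
    rw [hγ, Measure.map_add _ _ measurable_fst, Measure.map_map measurable_fst hdiag,
      Measure.map_smul, Measure.map_fst_prod, ← hmass, hcancel μ rfl]
    congr 1
    exact Measure.map_id
  have hsnd : γ.map Prod.snd = m + ν := by
    rw [hγ, Measure.map_add _ _ measurable_snd, Measure.map_map measurable_snd hdiag,
      Measure.map_smul, Measure.map_snd_prod, hcancel ν hmass.symm]
    congr 1
    exact Measure.map_id
  have hprob : IsProbabilityMeasure γ := by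
    constructor
    have : (m + μ) Set.univ = 1 := measure_univ
    rwa [← hfst, Measure.map_apply measurable_fst MeasurableSet.univ, Set.preimage_univ] at this
  have hc : ∀ κ : Measure (E d), κ Set.univ = μ Set.univ →
      (μ Set.univ)⁻¹ * (μ Set.univ * ∫⁻ x, edist x c ^ 2 ∂κ) = ∫⁻ x, edist x c ^ 2 ∂κ := by
    intro κ hκ
    conv_rhs => rw [← hcancel κ hκ]
    simp [lintegral_smul_measure]
  have hcost : ∫⁻ p, edist p.1 p.2 ^ 2 ∂γ ≤
      2 * (∫⁻ x, edist x c ^ 2 ∂μ + ∫⁻ x, edist x c ^ 2 ∂ν) := by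
    have hd2 : Measurable fun p : E d × E d => edist p.1 p.2 ^ 2 := by fun_prop
    have hd1 : Measurable fun x : E d => edist x c ^ 2 := by fun_prop
    rw [hγ, lintegral_add_measure, lintegral_map hd2 hdiag, lintegral_smul_measure]
    simp only [edist_self, ne_eq, OfNat.ofNat_ne_zero, not_false_eq_true, zero_pow,
      lintegral_zero, zero_add, smul_eq_mul]
    calc (μ Set.univ)⁻¹ * ∫⁻ p, edist p.1 p.2 ^ 2 ∂(μ.prod ν)
        ≤ (μ Set.univ)⁻¹ * ∫⁻ p, 2 * (edist p.1 c ^ 2 + edist p.2 c ^ 2) ∂(μ.prod ν) := by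
          gcongr
          exact edist_sq_le _ _ _
      _ = (μ Set.univ)⁻¹ * (2 * (μ Set.univ * ∫⁻ x, edist x c ^ 2 ∂μ
            + μ Set.univ * ∫⁻ x, edist x c ^ 2 ∂ν)) := by
          rw [lintegral_const_mul _ (by fun_prop), lintegral_add_left (by fun_prop)]
          congr 3
          · rw [← lintegral_map (μ := μ.prod ν) hd1 measurable_fst, Measure.map_fst_prod,
              lintegral_smul_measure, ← hmass, smul_eq_mul]
          · rw [← lintegral_map (μ := μ.prod ν) hd1 measurable_snd, Measure.map_snd_prod,
              lintegral_smul_measure, smul_eq_mul]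
      _ = 2 * ((μ Set.univ)⁻¹ * (μ Set.univ * ∫⁻ x, edist x c ^ 2 ∂μ)
            + (μ Set.univ)⁻¹ * (μ Set.univ * ∫⁻ x, edist x c ^ 2 ∂ν)) := by ring
      _ = _ := by rw [hc μ rfl, hc ν hmass.symm]
  unfold wasserstein2
  gcongr
  exact (iInf₂_le γ ⟨hprob, hfst, hsnd⟩).trans hcost

/-! ### Truncating the acceptance ratio at 2. -/

/-- The ratio `exp (g z - g x)` at `(x, z)`. -/
noncomputable def ratio {X : Type*} (g : X → ℝ) (p : X × X) : ℝ≥0∞ :=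
  ENNReal.ofReal (Real.exp (g p.2 - g p.1))

lemma measurable_ratio {X : Type*} [MeasurableSpace X] {g : X → ℝ} (hg : Measurable g) :
    Measurable (ratio g) := by
  unfold ratio
  fun_prop

/-- Exchanging the two independent coordinates inverts the ratio, so it suffices to average `min 2 a
+ min 2 a⁻¹ ≥ 2`. -/
lemma one_le_lintegral_min_ratio {X : Type*} [MeasurableSpace X] (φ : Measure X)
    [IsProbabilityMeasure φ] {g : X → ℝ} (hg : Measurable g) :
    1 ≤ ∫⁻ p, min 2 (ratio g p) ∂(φ.prod φ) := by
  have hm := measurable_ratio hg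
  have hswap : ∫⁻ p, min 2 (ratio g p.swap) ∂(φ.prod φ) = ∫⁻ p, min 2 (ratio g p) ∂(φ.prod φ) :=
    lintegral_prod_swap (fun p => min 2 (ratio g p))
  have hpt : ∀ p : X × X, 2 ≤ min 2 (ratio g p) + min 2 (ratio g p.swap) := by
    intro p
    have h2 : (2 : ℝ≥0∞) = ENNReal.ofReal 2 := by simp
    simp only [ratio, Prod.fst_swap, Prod.snd_swap]
    rw [h2, ← ENNReal.ofReal_min, ← ENNReal.ofReal_min, ← ENNReal.ofReal_add (by positivity)
      (by positivity)]
    refine ENNReal.ofReal_le_ofReal ?_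
    have hab : Real.exp (g p.2 - g p.1) * Real.exp (g p.1 - g p.2) = 1 := by
      rw [← Real.exp_add]; simp
    have ha := Real.exp_pos (g p.2 - g p.1)
    have hb := Real.exp_pos (g p.1 - g p.2)
    generalize Real.exp (g p.2 - g p.1) = a at *
    generalize Real.exp (g p.1 - g p.2) = b at *
    rcases min_cases 2 a with h | h <;> rcases min_cases 2 b with h' | h' <;> rw [h.1, h'.1]
    · linarith
    · linarith
    · linarith
    -- Neither minimum truncates here: `a + b ≥ 2` follows from `a * b = 1`.
    · nlinarith [sq_nonneg (a - b)]
  have hsum : 2 ≤ 2 * ∫⁻ p, min 2 (ratio g p) ∂(φ.prod φ) := by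
    calc (2 : ℝ≥0∞) = ∫⁻ _, 2 ∂(φ.prod φ) := by simp
      _ ≤ ∫⁻ p, min 2 (ratio g p) + min 2 (ratio g p.swap) ∂(φ.prod φ) := lintegral_mono hpt
      _ = _ := by
        rw [lintegral_add_left (by fun_prop), hswap, two_mul]
  have h2 : (2 : ℝ≥0∞) * 1 ≤ 2 * ∫⁻ p, min 2 (ratio g p) ∂(φ.prod φ) := by simpa using hsum
  exact (ENNReal.mul_le_mul_iff_right (by norm_num) (by norm_num)).1 h2

/-- The unnormalized law of the point accepted in one iteration (up to the factor `1 / 2`). -/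
noncomputable def acceptedMeasure {X : Type*} [MeasurableSpace X] (φ : Measure X) (g : X → ℝ) :
    Measure X :=
  ((φ.prod φ).withDensity fun p => min 2 (ratio g p)).map Prod.fst

/-- The part of the unnormalized target lost by truncating the acceptance probability. -/
noncomputable def excessMeasure {X : Type*} [MeasurableSpace X] (φ : Measure X) (g : X → ℝ) :
    Measure X :=
  ((φ.prod φ).withDensity fun p => ratio g p - 2).map Prod.fst

section

variable {X : Type*} [MeasurableSpace X] (φ : Measure X) {g : X → ℝ}

lemma lintegral_acceptedMeasure (hg : Measurable g) {h : X → ℝ≥0∞} (hh : Measurable h) :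
    ∫⁻ x, h x ∂(acceptedMeasure φ g) = ∫⁻ p, min 2 (ratio g p) * h p.1 ∂(φ.prod φ) := by
  have hm := measurable_ratio hg
  rw [acceptedMeasure, lintegral_map hh measurable_fst,
    lintegral_withDensity_eq_lintegral_mul _ (by fun_prop) (by fun_prop)]
  rfl

lemma lintegral_excessMeasure (hg : Measurable g) {h : X → ℝ≥0∞} (hh : Measurable h) :
    ∫⁻ x, h x ∂(excessMeasure φ g) = ∫⁻ p, (ratio g p - 2) * h p.1 ∂(φ.prod φ) := by
  have hm := measurable_ratio hg
  rw [excessMeasure, lintegral_map hh measurable_fst,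
    lintegral_withDensity_eq_lintegral_mul _ (by fun_prop) (by fun_prop)]
  rfl

lemma accepted_add_excess (hg : Measurable g) :
    acceptedMeasure φ g + excessMeasure φ g
      = ((φ.prod φ).withDensity (ratio g)).map Prod.fst := by
  have hm := measurable_ratio hg
  rw [acceptedMeasure, excessMeasure, ← Measure.map_add _ _ measurable_fst,
    ← withDensity_add_left (by fun_prop)]
  congr 2
  ext p
  rw [Pi.add_apply]
  rcases le_total 2 (ratio g p) with h | h
  · rw [min_eq_left h, add_tsub_cancel_of_le h]
  · rw [min_eq_right h, tsub_eq_zero_of_le h, add_zero]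

lemma acceptedMeasure_univ (hg : Measurable g) :
    acceptedMeasure φ g Set.univ = ∫⁻ p, min 2 (ratio g p) ∂(φ.prod φ) := by
  simpa using lintegral_acceptedMeasure φ hg (h := fun _ => 1) measurable_const

lemma excessMeasure_univ (hg : Measurable g) :
    excessMeasure φ g Set.univ = ∫⁻ p, (ratio g p - 2) ∂(φ.prod φ) := by
  simpa using lintegral_excessMeasure φ hg (h := fun _ => 1) measurable_const

variable [IsProbabilityMeasure φ]

lemma one_le_acceptedMeasure_univ (hg : Measurable g) : 1 ≤ acceptedMeasure φ g Set.univ := by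
  rw [acceptedMeasure_univ φ hg]
  exact one_le_lintegral_min_ratio φ hg

lemma acceptedMeasure_univ_le (hg : Measurable g) : acceptedMeasure φ g Set.univ ≤ 2 := by
  rw [acceptedMeasure_univ φ hg]
  calc ∫⁻ p, min 2 (ratio g p) ∂(φ.prod φ) ≤ ∫⁻ _, 2 ∂(φ.prod φ) :=
        lintegral_mono fun p => min_le_left _ _
    _ = 2 := by simp

lemma lintegral_acceptedMeasure_le (hg : Measurable g) {h : X → ℝ≥0∞} (hh : Measurable h) :
    ∫⁻ x, h x ∂(acceptedMeasure φ g) ≤ 2 * ∫⁻ x, h x ∂φ := by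
  rw [lintegral_acceptedMeasure φ hg hh]
  calc ∫⁻ p, min 2 (ratio g p) * h p.1 ∂(φ.prod φ) ≤ ∫⁻ p, 2 * h p.1 ∂(φ.prod φ) := by
        gcongr
        exact min_le_left _ _
    _ = _ := by
      rw [lintegral_const_mul _ (by fun_prop), ← lintegral_map hh measurable_fst]
      simp

/-- The two pieces add up to the full ratio, which factors as `exp (-g x) * exp (g z)`; integrating
out `z` leaves a multiple of the density `exp (-g)`. -/
lemma tilted_eq_smul_accepted_add_excess (hg : Measurable g)
    (hfin : excessMeasure φ g Set.univ ≠ ∞) :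
    φ.tilted (fun x => -g x) = (acceptedMeasure φ g Set.univ + excessMeasure φ g Set.univ)⁻¹ •
      (acceptedMeasure φ g + excessMeasure φ g) := by
  set I := ∫⁻ z, ENNReal.ofReal (Real.exp (g z)) ∂φ
  set J := ∫⁻ x, ENNReal.ofReal (Real.exp (-g x)) ∂φ
  have hm := measurable_ratio hg
  have hratio : ratio g = fun p : X × X =>
      ENNReal.ofReal (Real.exp (-g p.1)) * ENNReal.ofReal (Real.exp (g p.2)) := by
    ext p
    rw [ratio, ← ENNReal.ofReal_mul (by positivity), ← Real.exp_add]
    congr 2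
    ring
  have hmap : acceptedMeasure φ g + excessMeasure φ g
      = I • φ.withDensity (fun x => ENNReal.ofReal (Real.exp (-g x))) := by
    rw [accepted_add_excess φ hg]
    ext B hB
    rw [Measure.map_apply measurable_fst hB, withDensity_apply _ (measurable_fst hB),
      Measure.smul_apply, withDensity_apply _ hB, ← Set.prod_univ,
      ← Measure.prod_restrict, Measure.restrict_univ, hratio, smul_eq_mul]
    have := lintegral_prod_mul (μ := φ.restrict B) (ν := φ)
      (f := fun x => ENNReal.ofReal (Real.exp (-g x)))
      (g := fun x => ENNReal.ofReal (Real.exp (g x))) (by fun_prop) (by fun_prop)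
    rw [mul_comm] at this
    exact this
  have huniv : acceptedMeasure φ g Set.univ + excessMeasure φ g Set.univ = I * J := by
    have := congrArg (fun κ : Measure X => κ Set.univ) hmap
    simpa [J] using this
  have hpos : ∀ h : X → ℝ, Measurable h → ∫⁻ x, ENNReal.ofReal (Real.exp (h x)) ∂φ ≠ 0 := by
    intro h hh h0
    rw [lintegral_eq_zero_iff (by fun_prop)] at h0
    have : ∀ᵐ x ∂φ, False := by
      filter_upwards [h0] with x hx
      simp only [Pi.zero_apply, ENNReal.ofReal_eq_zero] at hx
      exact absurd (Real.exp_pos (h x)) (not_lt.2 hx)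
    simp only [eventually_false_iff_eq_bot, ae_eq_bot] at this
    exact IsProbabilityMeasure.ne_zero φ this
  have hI0 : I ≠ 0 := hpos g hg
  have hJ0 : J ≠ 0 := hpos (fun x => -g x) hg.neg
  -- Finite excess makes `I * J` finite, and as neither factor vanishes both are finite; so the
  -- normalizing integral in `Measure.tilted` is a genuine one.
  have hIJ : I * J ≠ ∞ := by
    rw [← huniv]
    exact ENNReal.add_ne_top.2 ⟨ne_top_of_le_ne_top (by simp) (acceptedMeasure_univ_le φ hg), hfin⟩
  have hIt : I ≠ ∞ := fun h => hIJ (by rw [h, ENNReal.top_mul hJ0])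
  have hJt : J ≠ ∞ := fun h => hIJ (by rw [h, ENNReal.mul_top hI0])
  have hint : ∫ x, Real.exp (-g x) ∂φ = J.toReal := by
    rw [integral_eq_lintegral_of_nonneg_ae (ae_of_all _ fun _ => (Real.exp_pos _).le) (by fun_prop)]
  rw [huniv, hmap, smul_smul, ENNReal.mul_inv (Or.inl hI0) (Or.inl hIt), mul_right_comm,
    ENNReal.inv_mul_cancel hI0 hIt, one_mul, Measure.tilted, hint,
    ← withDensity_smul _ (by fun_prop)]
  congr 1
  ext x
  rw [ENNReal.ofReal_div_of_pos (ENNReal.toReal_pos hJ0 hJt), ENNReal.ofReal_toReal hJt,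
    Pi.smul_apply, smul_eq_mul, ENNReal.div_eq_inv_mul]

end

lemma inv_sub_inv_add_le {a r : ℝ≥0∞} (ha : 1 ≤ a) (ha' : a ≠ ∞) (hr : r ≠ ∞) :
    a⁻¹ - (a + r)⁻¹ ≤ r := by
  have h0 : a ≠ 0 := fun h => by simp [h] at ha
  rw [tsub_le_iff_left]
  have hs0 : a + r ≠ 0 := by simp [h0]
  have hst : a + r ≠ ∞ := ENNReal.add_ne_top.2 ⟨ha', hr⟩
  calc a⁻¹ = (a + r)⁻¹ * (a⁻¹ * (a + r)) := by
        rw [mul_left_comm, ENNReal.inv_mul_cancel hs0 hst, mul_one]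
    _ = (a + r)⁻¹ + (a + r)⁻¹ * a⁻¹ * r := by
        rw [mul_add, ENNReal.inv_mul_cancel h0 ha', mul_add, mul_one, mul_assoc]
    _ ≤ (a + r)⁻¹ + 1 * 1 * r := by
        gcongr
        · exact ENNReal.inv_le_one.2 (ha.trans le_self_add)
        · exact ENNReal.inv_le_one.2 ha
    _ = _ := by simp

/-- With `a`, `r` the accepted and excess masses, the common part is `(a + r)⁻¹` times the accepted
measure. One remainder has weight at most `r ≤ Y` and second moment at most `2 V`, as the density is
at most 2; the other costs at most `V Y` by Cauchy–Schwarz. Hence `6 = 2 * (2 + 1)`. -/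
theorem wasserstein2_accepted_tilted_le {d : ℕ} (φ : Measure (E d)) [IsProbabilityMeasure φ]
    {g : E d → ℝ} (hg : Measurable g) (c : E d) {V Y : ℝ≥0∞}
    (hV : ∫⁻ x, edist x c ^ 4 ∂φ ≤ V ^ 2)
    (hY : ∫⁻ p, (ratio g p - 2) ^ 2 ∂(φ.prod φ) ≤ Y ^ 2) (hYt : Y ≠ ∞) :
    wasserstein2 ((acceptedMeasure φ g Set.univ)⁻¹ • acceptedMeasure φ g)
      (φ.tilted fun x => -g x) ≤ (6 * (V * Y)) ^ (1 / 2 : ℝ) := by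
  have hm := measurable_ratio hg
  have hCS : ∀ {Ω : Type} [MeasurableSpace Ω] (κ : Measure Ω) (u v : Ω → ℝ≥0∞),
      Measurable u → Measurable v → ∀ U W : ℝ≥0∞, ∫⁻ x, u x ^ 2 ∂κ ≤ U ^ 2 →
      ∫⁻ x, v x ^ 2 ∂κ ≤ W ^ 2 → ∫⁻ x, u x * v x ∂κ ≤ U * W := by
    intro Ω _ κ u v hu hv U W hU hW
    have h := ENNReal.lintegral_mul_le_Lp_mul_Lq κ Real.HolderConjugate.two_two hu.aemeasurable
      hv.aemeasurable
    simp only [ENNReal.rpow_ofNat, Pi.mul_apply] at h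
    refine h.trans ?_
    have hs : ∀ a : ℝ≥0∞, (a ^ 2) ^ (1 / 2 : ℝ) = a := by
      intro a
      rw [← ENNReal.rpow_natCast_mul]
      norm_num
    calc _ ≤ (U ^ 2) ^ (1 / 2 : ℝ) * (W ^ 2) ^ (1 / 2 : ℝ) := by gcongr
      _ = _ := by rw [hs, hs]
  have hV1 : ∫⁻ x, edist x c ^ 2 ∂φ ≤ V := by
    have := hCS φ (fun x => edist x c ^ 2) (fun _ => 1) (by fun_prop) (by fun_prop) V 1
      (by simpa [← pow_mul] using hV) (by simp)
    simpa using this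
  have hY1 : excessMeasure φ g Set.univ ≤ Y := by
    rw [excessMeasure_univ φ hg]
    have := hCS (φ.prod φ) (fun p => ratio g p - 2) (fun _ => 1) (by fun_prop) (by fun_prop) Y 1
      hY (by simp)
    simpa using this
  have hVY : ∫⁻ x, edist x c ^ 2 ∂(excessMeasure φ g) ≤ V * Y := by
    rw [lintegral_excessMeasure φ hg (by fun_prop), mul_comm V]
    refine hCS (φ.prod φ) _ (fun p => edist p.1 c ^ 2) (by fun_prop) (by fun_prop) Y V hY ?_
    rw [← lintegral_map (μ := φ.prod φ) (f := fun x => (edist x c ^ 2) ^ 2) (by fun_prop)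
      measurable_fst]
    simpa [← pow_mul] using hV
  have hexc : excessMeasure φ g Set.univ ≠ ∞ := ne_top_of_le_ne_top hYt hY1
  have ha1 := one_le_acceptedMeasure_univ φ hg
  have hat : acceptedMeasure φ g Set.univ ≠ ∞ :=
    ne_top_of_le_ne_top (by simp) (acceptedMeasure_univ_le φ hg)
  have ha0 : acceptedMeasure φ g Set.univ ≠ 0 := fun h => by simp [h] at ha1
  rw [tilted_eq_smul_accepted_add_excess φ hg hexc]
  set a := acceptedMeasure φ g Set.univ with ha
  set r := excessMeasure φ g Set.univ with hr
  have hle : (a + r)⁻¹ ≤ a⁻¹ := ENNReal.inv_le_inv.2 le_self_add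
  have hdec : a⁻¹ • acceptedMeasure φ g
      = (a + r)⁻¹ • acceptedMeasure φ g + (a⁻¹ - (a + r)⁻¹) • acceptedMeasure φ g := by
    rw [← add_smul, add_tsub_cancel_of_le hle]
  rw [hdec, smul_add]
  have hp1 : IsProbabilityMeasure ((a + r)⁻¹ • acceptedMeasure φ g
      + (a⁻¹ - (a + r)⁻¹) • acceptedMeasure φ g) := by
    rw [← hdec]
    constructor
    rw [Measure.smul_apply, smul_eq_mul, ← ha, ENNReal.inv_mul_cancel ha0 hat]
  have hp2 : IsProbabilityMeasure ((a + r)⁻¹ • acceptedMeasure φ g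
      + (a + r)⁻¹ • excessMeasure φ g) := by
    constructor
    rw [Measure.add_apply, Measure.smul_apply, Measure.smul_apply, smul_eq_mul, smul_eq_mul,
      ← mul_add, ← ha, ← hr]
    exact ENNReal.inv_mul_cancel (by simp [ha0]) (ENNReal.add_ne_top.2 ⟨hat, hexc⟩)
  refine (wasserstein2_add_le _ _ _ c).trans (ENNReal.rpow_le_rpow ?_ (by norm_num))
  rw [lintegral_smul_measure, lintegral_smul_measure, smul_eq_mul, smul_eq_mul]
  calc 2 * ((a⁻¹ - (a + r)⁻¹) * ∫⁻ x, edist x c ^ 2 ∂(acceptedMeasure φ g)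
        + (a + r)⁻¹ * ∫⁻ x, edist x c ^ 2 ∂(excessMeasure φ g))
      ≤ 2 * (Y * (2 * V) + 1 * (V * Y)) := by
        gcongr
        · exact (inv_sub_inv_add_le ha1 hat hexc).trans hY1
        · refine (lintegral_acceptedMeasure_le φ hg (by fun_prop)).trans ?_
          gcongr
        · exact ENNReal.inv_le_one.2 (ha1.trans le_self_add)
    _ = 6 * (V * Y) := by ring

/-! ### The law and the cost of the sampler. -/

lemma volume_unitInterval_le {t : ℝ} (ht : 0 ≤ t) :
    volume {u : unitInterval | (u : ℝ) ≤ t} = min 1 (ENNReal.ofReal t) := by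
  rcases le_total t 1 with h | h
  · have : {u : unitInterval | (u : ℝ) ≤ t} = Set.Iic ⟨t, ht, h⟩ := by
      ext u
      exact Iff.rfl
    rw [this, unitInterval.volume_Iic, min_eq_right]
    exact ENNReal.ofReal_le_one.2 h
  · have : {u : unitInterval | (u : ℝ) ≤ t} = Set.univ :=
      Set.eq_univ_of_forall fun u => u.2.2.trans h
    rw [this, measure_univ, min_eq_left]
    exact ENNReal.one_le_ofReal.2 h

section Sampler

variable {d : ℕ} (f : E d → ℝ) (v : E d)

/-- The draws that are accepted. -/
def acceptSet : Set (Draw d) :=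
  {w | (w.2.2 : ℝ) ≤ 1 / 2 * Real.exp ((f w.2.1 - ⟪v, w.2.1⟫) - (f w.1 - ⟪v, w.1⟫))}

variable {f}

lemma measurableSet_acceptSet (hf : Measurable f) : MeasurableSet (acceptSet f v) :=
  measurableSet_le (by fun_prop) (by fun_prop)

/-- Integrating out `u` leaves the acceptance probability `min 1 (ρ / 2) = min 2 ρ / 2`. -/
lemma map_fst_restrict_acceptSet (hf : Measurable f) (φ : Measure (E d))
    [IsProbabilityMeasure φ] :
    ((φ.prod (φ.prod (volume : Measure unitInterval))).restrict (acceptSet f v)).map Prod.fst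
      = (2 : ℝ≥0∞)⁻¹ • acceptedMeasure φ (fun x => f x - ⟪v, x⟫) := by
  have hA := measurableSet_acceptSet v hf
  set g : E d → ℝ := fun x => f x - ⟪v, x⟫ with hg
  have hgm : Measurable g := by fun_prop
  have hm := measurable_ratio hgm
  ext B hB
  have hBA : MeasurableSet (Prod.fst ⁻¹' B ∩ acceptSet f v) := (measurable_fst hB).inter hA
  rw [Measure.map_apply measurable_fst hB, Measure.restrict_apply (measurable_fst hB),
    Measure.prod_apply hBA, Measure.smul_apply, acceptedMeasure, Measure.map_apply measurable_fst hB,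
    withDensity_apply _ (measurable_fst hB), ← lintegral_indicator (measurable_fst hB), smul_eq_mul,
    lintegral_prod _ (Measurable.aemeasurable (Measurable.indicator (by fun_prop)
      (measurable_fst hB))), ← lintegral_const_mul' _ _ (by simp)]
  refine lintegral_congr fun x => ?_
  rw [Measure.prod_apply (measurable_prodMk_left hBA), ← lintegral_const_mul' _ _ (by simp)]
  refine lintegral_congr fun z => ?_
  by_cases hx : x ∈ B
  · have hset : Prod.mk z ⁻¹' (Prod.mk x ⁻¹' (Prod.fst ⁻¹' B ∩ acceptSet f v))
        = {u : unitInterval | (u : ℝ) ≤ 1 / 2 * Real.exp (g z - g x)} := by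
      ext u
      simp [hx, acceptSet, hg]
    rw [hset, volume_unitInterval_le (by positivity), Set.indicator_of_mem (by exact hx), ratio,
      mul_min, ENNReal.inv_mul_cancel (by simp) (by simp), ENNReal.ofReal_mul (by norm_num)]
    congr 2
    rw [one_div, ENNReal.ofReal_inv_of_pos (by norm_num)]
    simp
  · have hset : Prod.mk z ⁻¹' (Prod.mk x ⁻¹' (Prod.fst ⁻¹' B ∩ acceptSet f v)) = ∅ := by
      ext u
      simp [hx]
    rw [hset, measure_empty, Set.indicator_of_notMem (by exact hx), mul_zero]

lemma measure_acceptSet (hf : Measurable f) (φ : Measure (E d)) [IsProbabilityMeasure φ] :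
    (φ.prod (φ.prod (volume : Measure unitInterval))) (acceptSet f v)
      = 2⁻¹ * acceptedMeasure φ (fun x => f x - ⟪v, x⟫) Set.univ := by
  have h := congrArg (fun κ : Measure (E d) => κ Set.univ) (map_fst_restrict_acceptSet v hf φ)
  simpa [Measure.map_apply measurable_fst MeasurableSet.univ] using h

lemma half_le_measure_acceptSet (hf : Measurable f) (φ : Measure (E d))
    [IsProbabilityMeasure φ] :
    2⁻¹ ≤ (φ.prod (φ.prod (volume : Measure unitInterval))) (acceptSet f v) := by
  rw [measure_acceptSet v hf φ]
  calc (2⁻¹ : ℝ≥0∞) = 2⁻¹ * 1 := by simp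
    _ ≤ _ := by
      gcongr
      exact one_le_acceptedMeasure_univ φ (by fun_prop)

lemma ae_terminates {η : ℝ} (hη : 0 < η) (c : E d) (hf : Measurable f) :
    ∀ᵐ ω ∂(drawLaw η c), Terminates f v ω := by
  have := isProbabilityMeasure_proposal hη c
  refine ae_infinitePi_exists_mem _ (measurableSet_acceptSet v hf) fun h0 => ?_
  have := half_le_measure_acceptSet v hf (proposal η c)
  simp [h0] at this

/-- Each executed iteration makes 2 queries, and the survival probabilities sum to the inverse of
the acceptance probability, at most 2. -/
lemma expectedQueries_le {η : ℝ} (hη : 0 < η) (c : E d) (hf : Measurable f) :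
    expectedQueries f v η c ≤ 4 := by
  classical
  have := isProbabilityMeasure_proposal hη c
  have hA := measurableSet_acceptSet v hf
  set ν := (proposal η c).prod ((proposal η c).prod (volume : Measure unitInterval)) with hν
  have hS : ∀ k, MeasurableSet {ω : ℕ → Draw d | ∀ i < k, ω i ∉ acceptSet f v} := by
    intro k
    have : {ω : ℕ → Draw d | ∀ i < k, ω i ∉ acceptSet f v}
        = ⋂ i ∈ Set.Iio k, {ω | ω i ∈ acceptSet f v}ᶜ := by
      ext; simp
    rw [this]
    exact MeasurableSet.biInter (Set.to_countable _) fun i _ => (measurable_pi_apply i hA).compl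
  have hq : ∀ ω : ℕ → Draw d, totalQueries f v ω
      = ∑' k, {ω : ℕ → Draw d | ∀ i < k, ω i ∉ acceptSet f v}.indicator (fun _ => 2) ω := by
    intro ω
    refine tsum_congr fun k => ?_
    by_cases h : ∀ i < k, ω i ∉ acceptSet f v
    · rw [Set.indicator_of_mem (by exact h), if_pos (by exact h)]
      simp [acceptanceTest, OracleProgram.queries]
    · rw [Set.indicator_of_notMem (by exact h), if_neg (by exact h)]
  calc expectedQueries f v η c
      = ∑' k, 2 * Measure.infinitePi (fun _ : ℕ => ν)
          {ω | ∀ i < k, ω i ∉ acceptSet f v} := by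
        rw [expectedQueries, drawLaw, lintegral_congr hq,
          lintegral_tsum fun k => (measurable_const.indicator (hS k)).aemeasurable]
        refine tsum_congr fun k => ?_
        rw [lintegral_indicator (hS k), setLIntegral_const]
    _ = 2 * (ν (acceptSet f v))⁻¹ := by
        rw [ENNReal.tsum_mul_left, tsum_infinitePi_forall_lt_notMem ν hA]
    _ ≤ 2 * (2⁻¹)⁻¹ := by
        gcongr
        exact half_le_measure_acceptSet v hf (proposal η c)
    _ = 4 := by
        rw [inv_inv]
        norm_num

lemma outputLaw_eq {η : ℝ} (hη : 0 < η) (c : E d) (hf : Measurable f) :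
    outputLaw f v η c = (acceptedMeasure (proposal η c) (fun x => f x - ⟪v, x⟫) Set.univ)⁻¹ •
      acceptedMeasure (proposal η c) (fun x => f x - ⟪v, x⟫) := by
  have := isProbabilityMeasure_proposal hη c
  have hA := measurableSet_acceptSet v hf
  set ν := (proposal η c).prod ((proposal η c).prod (volume : Measure unitInterval)) with hν
  have h0 : ν (acceptSet f v) ≠ 0 := by
    intro h0
    have := half_le_measure_acceptSet v hf (proposal η c)
    rw [← hν, h0] at this
    simp at this
  have hout : output f v = Prod.fst ∘ fun ω : ℕ → Draw d => ω (sInf {k | ω k ∈ acceptSet f v}) :=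
    rfl
  rw [outputLaw, hout, ← Measure.map_map measurable_fst (measurable_firstHit hA), drawLaw,
    map_firstHit_infinitePi ν hA h0, Measure.map_smul, hν, map_fst_restrict_acceptSet v hf, smul_smul,
    measure_acceptSet v hf, ENNReal.mul_inv (by simp) (by simp), inv_inv, mul_right_comm,
    ENNReal.mul_inv_cancel (by simp) (by simp), one_mul]

/-- Stationarity means `y = c + η v`, so recentring the quadratic from `y` to `c` produces exactly
the linear term `⟪v, x⟫`, up to a constant that normalization removes. -/
lemma target_eq_tilted_proposal {η : ℝ} (hη : 0 < η) (c y : E d)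
    (hc : v + (1 / η) • (c - y) = 0) :
    target f η y = (proposal η c).tilted fun x => -(f x - ⟪v, x⟫) := by
  have hy : y = c + η • v := by
    have : v = (1 / η) • (y - c) := by
      rw [eq_neg_of_add_eq_zero_left hc, ← smul_neg, neg_sub]
    rw [this, smul_smul, mul_one_div_cancel hη.ne', one_smul]
    abel
  rw [proposal, tilted_tilted (integrable_exp_proposal hη c), target]
  have hexp : ∀ x, Real.exp (-(1 / (2 * η) * ‖x - c‖ ^ 2) + -(f x - ⟪v, x⟫)) = Real.exp (⟪v, c⟫ + η / 2 * ‖v‖ ^ 2) *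
        Real.exp (-f x - 1 / (2 * η) * ‖x - y‖ ^ 2) := by
    intro x
    rw [← Real.exp_add, hy, ← sub_sub, norm_sub_sq_real (x - c), inner_smul_right,
      inner_sub_left, norm_smul, Real.norm_of_nonneg hη.le, real_inner_comm, real_inner_comm v c]
    congr 1
    field_simp
    ring
  rw [Measure.tilted, Measure.tilted]
  simp only [Pi.add_apply, hexp, integral_const_mul]
  congr 1
  ext x
  rw [mul_div_mul_left _ _ (Real.exp_pos _).ne']

end Sampler

/-! ### Growth of the rescaled gradient. -/

section Gradient

/-- One summand of `√(η M_{L,d})`. -/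
noncomputable def stepScale (d : ℕ) (η L α : ℝ) : ℝ :=
  √η * (L ^ (1 / (α + 1)) * (d : ℝ) ^ (α / (2 * (α + 1))))

/-- This replaces the different powers `αⱼ` by one common bound, so that the sum over `j` factors.
-/
lemma rpow_le_sqrt_one_add_sq {y α : ℝ} (hy : 0 ≤ y) (h0 : 0 ≤ α) (h1 : α ≤ 1) :
    y ^ α ≤ √(1 + y ^ 2) := by
  rcases le_total y 1 with h | h
  · refine (Real.rpow_le_one hy h h0).trans ?_
    rw [Real.one_le_sqrt]
    nlinarith [sq_nonneg y]
  · refine (Real.rpow_le_rpow_of_exponent_le h h1).trans ?_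
    rw [Real.rpow_one]
    exact Real.le_sqrt_of_sq_le (by linarith)

/-- The exponents in `stepScale` are those for which its power `1 + α` is `√η ^ (1 + α) * L * √d ^
α`; the natural unit of `r` becomes `√d`, the size of a Gaussian vector. -/
lemma sqrt_mul_rpow_eq {d : ℕ} (hd : 0 < d) {η L α : ℝ} (hη : 0 < η) (hL : 0 < L) (h0 : 0 ≤ α)
    {r : ℝ} (hr : 0 ≤ r) :
    √η * (L * (√η * r) ^ α) = stepScale d η L α * (stepScale d η L α * r / √d) ^ α := by
  have hd0 : (0 : ℝ) < d := by exact_mod_cast hd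
  have hα : 0 < α + 1 := by linarith
  have hb : 0 < L ^ (1 / (α + 1)) := by positivity
  have he : 0 < (d : ℝ) ^ (α / (2 * (α + 1))) := by positivity
  have hbL : L ^ (1 / (α + 1)) * (L ^ (1 / (α + 1))) ^ α = L := by
    rw [← Real.rpow_one_add' hb.le (by linarith), ← Real.rpow_mul hL.le]
    rw [show 1 / (α + 1) * (1 + α) = 1 by field_simp; ring, Real.rpow_one]
  have heD : (d : ℝ) ^ (α / (2 * (α + 1))) * ((d : ℝ) ^ (α / (2 * (α + 1)))) ^ α = (√d) ^ α := by
    rw [← Real.rpow_one_add' he.le (by linarith), ← Real.rpow_mul hd0.le, Real.sqrt_eq_rpow,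
      ← Real.rpow_mul hd0.le]
    congr 1
    field_simp
    ring
  have hsd : 0 < (√d) ^ α := by positivity
  unfold stepScale
  rw [Real.div_rpow (by positivity) (by positivity), Real.mul_rpow (Real.sqrt_nonneg η) hr,
    Real.mul_rpow (x := √η * _) (by positivity) hr,
    Real.mul_rpow (x := √η) (y := _ * _) (Real.sqrt_nonneg η) (by positivity),
    Real.mul_rpow hb.le he.le]
  rw [← heD] at hsd ⊢
  conv_lhs => rw [← hbL]
  field_simp

lemma sqrt_mul_rpow_le {d : ℕ} (hd : 0 < d) {η L α S : ℝ} (hη : 0 < η) (hL : 0 < L)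
    (h0 : 0 ≤ α) (h1 : α ≤ 1) (hS : stepScale d η L α ≤ S) {r : ℝ} (hr : 0 ≤ r) :
    √η * (L * (√η * r) ^ α) ≤ stepScale d η L α * √(1 + S ^ 2 / d * r ^ 2) := by
  have hs : 0 ≤ stepScale d η L α := by unfold stepScale; positivity
  rw [sqrt_mul_rpow_eq hd hη hL h0 hr]
  gcongr
  refine (rpow_le_sqrt_one_add_sq (by positivity) h0 h1).trans (Real.sqrt_le_sqrt ?_)
  rw [div_pow, mul_pow, Real.sq_sqrt (by positivity), mul_div_right_comm]
  gcongr

variable {d n : ℕ} {L α : Fin n → ℝ} {f : Fin n → E d → ℝ} {f' : Fin n → E d → E d}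

lemma locallyLipschitz_sum (hf : ∀ j, SemiSmooth (f j) (f' j) (L j) (α j)) :
    LocallyLipschitz fun x => ∑ j, f j x := by
  suffices h : ∀ s : Finset (Fin n), LocallyLipschitz fun x => ∑ j ∈ s, f j x from h _
  intro s
  induction s using Finset.induction_on with
  | empty => simpa using LocallyLipschitz.const (0 : ℝ)
  | insert a s ha ih =>
    simp_rw [Finset.sum_insert ha]
    exact (hf a).isSubgradient.locallyLipschitz.add ih

lemma ae_hasGradientAt_sum (hf : ∀ j, SemiSmooth (f j) (f' j) (L j) (α j)) :
    ∀ᵐ x : E d, HasGradientAt (fun x => ∑ j, f j x) (∑ j, f' j x) x := by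
  filter_upwards [ae_all_iff.2 fun j => (hf j).isSubgradient.ae_hasGradientAt] with x hx
  rw [hasGradientAt_iff_hasFDerivAt, map_sum]
  exact HasFDerivAt.fun_sum fun j _ => (hx j).hasFDerivAt

lemma ae_norm_gradient_sq_le (hd : 0 < d) (hL : ∀ j, 0 < L j) (hα : ∀ j, 0 ≤ α j ∧ α j ≤ 1)
    (hf : ∀ j, SemiSmooth (f j) (f' j) (L j) (α j)) {η : ℝ} (hη : 0 < η) (c : E d) :
    ∀ᵐ w ∂(stdGaussian (E d)),
      DifferentiableAt ℝ (fun w : E d => (∑ j, f j (c + √η • w)) - ⟪∑ j, f' j c, c + √η • w⟫) w ∧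
      ‖gradient (fun w : E d => (∑ j, f j (c + √η • w)) - ⟪∑ j, f' j c, c + √η • w⟫) w‖ ^ 2 ≤
        η * compositeConst L α d * (1 + η * compositeConst L α d / d * ‖w‖ ^ 2) := by
  -- The gradient is known only Lebesgue almost everywhere, which suffices because the proposal has
  -- a density.
  have hac : (stdGaussian (E d)).map (fun x => c + √η • x) ≪ volume := by
    rw [← proposal_eq_map hη c]
    exact tilted_absolutelyContinuous _ _
  have h1 := ae_of_ae_map (f := fun x => c + √η • x) (by fun_prop)
    (hac.ae_le (ae_hasGradientAt_sum hf))
  set S := ∑ j, stepScale d η (L j) (α j) with hS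
  have hS2 : S ^ 2 = η * compositeConst L α d := by
    simp_rw [hS, stepScale, ← Finset.mul_sum, mul_pow, Real.sq_sqrt hη.le]
    rfl
  have hsj : ∀ j, 0 ≤ stepScale d η (L j) (α j) := fun j => by
    have := hL j
    unfold stepScale
    positivity
  filter_upwards [h1] with w hw
  have haff : HasFDerivAt (fun w : E d => c + √η • w) (√η • ContinuousLinearMap.id ℝ (E d)) w :=
    ((hasFDerivAt_id w).const_smul √η).const_add c
  have hG : HasGradientAt (fun w : E d => (∑ j, f j (c + √η • w)) - ⟪∑ j, f' j c, c + √η • w⟫)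
      (√η • ((∑ j, f' j (c + √η • w)) - ∑ j, f' j c)) w := by
    rw [hasGradientAt_iff_hasFDerivAt]
    have h2 := (hw.hasFDerivAt.comp w haff).sub
      ((innerSL ℝ (∑ j, f' j c)).hasFDerivAt.comp w haff)
    refine h2.congr_fderiv ?_
    ext u
    simp [mul_sub]
  refine ⟨hG.differentiableAt, ?_⟩
  rw [hG.gradient, ← hS2]
  have hnorm : ‖√η • ((∑ j, f' j (c + √η • w)) - ∑ j, f' j c)‖
      ≤ S * √(1 + S ^ 2 / d * ‖w‖ ^ 2) := by
    rw [norm_smul, Real.norm_of_nonneg (Real.sqrt_nonneg _), ← Finset.sum_sub_distrib, hS,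
      Finset.sum_mul]
    calc √η * ‖∑ j, (f' j (c + √η • w) - f' j c)‖
        ≤ √η * ∑ j, L j * (√η * ‖w‖) ^ α j := by
          gcongr
          refine (norm_sum_le _ _).trans (Finset.sum_le_sum fun j _ => ?_)
          refine ((hf j).holder _ _).trans_eq ?_
          rw [add_sub_cancel_left, norm_smul, Real.norm_of_nonneg (Real.sqrt_nonneg _)]
      _ ≤ _ := by
          rw [Finset.mul_sum]
          refine Finset.sum_le_sum fun j _ => ?_
          exact sqrt_mul_rpow_le hd hη (hL j) (hα j).1 (hα j).2
            (Finset.single_le_sum (fun i _ => hsj i) (Finset.mem_univ j)) (norm_nonneg _)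
  calc _ ≤ (S * √(1 + S ^ 2 / d * ‖w‖ ^ 2)) ^ 2 := by gcongr
    _ = _ := by rw [mul_pow, Real.sq_sqrt (by positivity)]

end Gradient

/-! ### Moments of the proposal and tail of the ratio. -/

lemma lintegral_proposal_prod {d : ℕ} {η : ℝ} (hη : 0 < η) (c : E d) {F : E d × E d → ℝ≥0∞}
    (hF : Measurable F) :
    ∫⁻ p, F p ∂((proposal η c).prod (proposal η c))
      = ∫⁻ p, F (c + √η • p.1, c + √η • p.2)
        ∂((stdGaussian (E d)).prod (stdGaussian (E d))) := by
  rw [proposal_eq_map hη, Measure.map_prod_map _ _ (by fun_prop) (by fun_prop),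
    lintegral_map hF (by fun_prop)]
  rfl

/-- A Chernoff bound: the left side vanishes unless `ρ > 2`, and then `ρ² = 4 (ρ/2)² ≤ 4 (ρ/2) ^ s`.
-/
lemma ratio_sub_two_sq_le {X : Type*} (g : X → ℝ) {s : ℝ} (hs : 2 ≤ s) (p : X × X) :
    (ratio g p - 2) ^ 2 ≤ ENNReal.ofReal (4 * Real.exp (-s * Real.log 2)) *
      ENNReal.ofReal (Real.exp (s * (g p.2 - g p.1))) := by
  set X := g p.2 - g p.1
  rcases le_total X (Real.log 2) with h | h
  · have : ratio g p ≤ 2 := by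
      rw [ratio, show (2 : ℝ≥0∞) = ENNReal.ofReal 2 by simp]
      refine ENNReal.ofReal_le_ofReal ?_
      rwa [← Real.le_log_iff_exp_le (by norm_num)]
    rw [tsub_eq_zero_of_le this]
    simp
  · calc (ratio g p - 2) ^ 2 ≤ ratio g p ^ 2 := by gcongr; exact tsub_le_self
      _ ≤ _ := by
        rw [ratio, ← ENNReal.ofReal_pow (by positivity), ← ENNReal.ofReal_mul (by positivity)]
        refine ENNReal.ofReal_le_ofReal ?_
        have h4 : (4 : ℝ) = Real.exp (2 * Real.log 2) := by
          rw [mul_comm, Real.exp_mul, Real.exp_log (by norm_num)]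
          norm_num
        rw [h4, ← Real.exp_nat_mul, ← Real.exp_add, ← Real.exp_add]
        refine Real.exp_le_exp.2 ?_
        push_cast
        nlinarith

/-- Apply `t² / 2 ≤ exp t` at `t = ‖w‖² / (4 d)`; the exponential moment is at most `exp (1/2) ≤ 2`,
and `32 * 2 = 8²`. -/
lemma lintegral_edist_pow_four_proposal_le {d : ℕ} (hd : 0 < d) {η : ℝ} (hη : 0 < η)
    (hη1 : η ≤ 1) (c : E d) :
    ∫⁻ x, edist x c ^ 4 ∂(proposal η c) ≤ ENNReal.ofReal (8 * d) ^ 2 := by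
  have hd0 : (0 : ℝ) < d := by exact_mod_cast hd
  rw [proposal_eq_map hη, lintegral_map (by fun_prop) (by fun_prop)]
  calc ∫⁻ w, edist (c + √η • w) c ^ 4 ∂(stdGaussian (E d))
      ≤ ∫⁻ w, ENNReal.ofReal (32 * d ^ 2) * ENNReal.ofReal (Real.exp (1 / 4 / d * ‖w‖ ^ 2))
          ∂(stdGaussian (E d)) := by
        refine lintegral_mono fun w => ?_
        rw [edist_dist, ← ENNReal.ofReal_pow dist_nonneg, ← ENNReal.ofReal_mul (by positivity)]
        refine ENNReal.ofReal_le_ofReal ?_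
        rw [dist_eq_norm, add_sub_cancel_left, norm_smul, Real.norm_of_nonneg (Real.sqrt_nonneg _),
          mul_pow]
        have h1 : √η ^ 4 ≤ 1 := pow_le_one₀ (Real.sqrt_nonneg _) (Real.sqrt_le_one.2 hη1)
        have h2 := Real.quadratic_le_exp_of_nonneg (x := 1 / 4 / d * ‖w‖ ^ 2) (by positivity)
        have h3 : 0 ≤ 1 / 4 / d * ‖w‖ ^ 2 := by positivity
        have h4 : (1 / 4 / d * ‖w‖ ^ 2) ^ 2 / 2 ≤ Real.exp (1 / 4 / d * ‖w‖ ^ 2) := by linarith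
        calc √η ^ 4 * ‖w‖ ^ 4 ≤ 1 * ‖w‖ ^ 4 := by gcongr
          _ = 32 * d ^ 2 * ((1 / 4 / d * ‖w‖ ^ 2) ^ 2 / 2) := by field_simp; ring
          _ ≤ _ := by gcongr
    _ ≤ ENNReal.ofReal (32 * d ^ 2) * ENNReal.ofReal (Real.exp (2 * (1 / 4))) := by
        rw [lintegral_const_mul' _ _ ENNReal.ofReal_ne_top]
        gcongr
        exact lintegral_exp_norm_sq_stdGaussian_le hd (by norm_num) le_rfl
    _ ≤ ENNReal.ofReal (8 * d) ^ 2 := by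
        rw [← ENNReal.ofReal_mul (by positivity), ← ENNReal.ofReal_pow (by positivity)]
        refine ENNReal.ofReal_le_ofReal ?_
        have : Real.exp (2 * (1 / 4)) ≤ 2 := by
          rw [← Real.le_log_iff_exp_le (by norm_num)]
          linarith [Real.log_two_gt_d9]
        nlinarith [sq_nonneg (d : ℝ)]

/-- The tail of the acceptance ratio, from a gradient bound on `g (c + √η ·)`. -/
lemma lintegral_ratio_sub_two_sq_le {d : ℕ} (hd : 0 < d) {η : ℝ} (hη : 0 < η) (c : E d)
    {g : E d → ℝ} (hg : LocallyLipschitz g) {a Λ : ℝ} (ha : 0 ≤ a) (hΛ : 2 ≤ Λ)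
    (haΛ : 49 * (a * Λ) ≤ 1)
    (hgrad : ∀ᵐ w ∂(stdGaussian (E d)), DifferentiableAt ℝ (fun w => g (c + √η • w)) w ∧
      ‖gradient (fun w => g (c + √η • w)) w‖ ^ 2 ≤ a * (1 + a / d * ‖w‖ ^ 2)) :
    ∫⁻ p, (ratio g p - 2) ^ 2 ∂((proposal η c).prod (proposal η c))
      ≤ ENNReal.ofReal (2 * Real.exp (-Λ)) ^ 2 := by
  have hd0 : (0 : ℝ) < d := by exact_mod_cast hd
  have hgm : Measurable g := hg.continuous.measurable
  have haff : LocallyLipschitz fun w : E d => c + √η • w := by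
    refine ContDiff.locallyLipschitz (𝕂 := ℝ) ?_
    fun_prop
  have hG : LocallyLipschitz fun w : E d => g (c + √η • w) := hg.comp haff
  -- The exponent `s = 4 Λ` gains `2 ^ (-4 Λ)` from truncation and costs `exp (Λ / 2)` in the moment
  -- bound; since `4 log 2 - 1/2 ≥ 2`, the factor `exp (-2 Λ)` remains.
  have hMP := lintegral_exp_sub_le hG (hgrad.mono fun _ h => h.1) (4 * Λ)
  have hgauss : ∫⁻ x, ENNReal.ofReal (Real.exp ((4 * Λ) ^ 2 * Real.pi ^ 2 / 8 *
      ‖gradient (fun w => g (c + √η • w)) x‖ ^ 2)) ∂(stdGaussian (E d))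
      ≤ ENNReal.ofReal (Real.exp (Λ / 2)) := by
    have hpi : Real.pi ^ 2 ≤ 10 := by nlinarith [Real.pi_pos, Real.pi_lt_d2]
    calc _ ≤ ∫⁻ w, ENNReal.ofReal (Real.exp (20 / 49 * Λ)) *
          ENNReal.ofReal (Real.exp (20 / 2401 / d * ‖w‖ ^ 2)) ∂(stdGaussian (E d)) := by
          refine lintegral_mono_ae ?_
          filter_upwards [hgrad] with w hw
          rw [← ENNReal.ofReal_mul (by positivity), ← Real.exp_add]
          refine ENNReal.ofReal_le_ofReal (Real.exp_le_exp.2 ?_)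
          -- `16 * 10 / 8 = 20`, from `π² ≤ 10`.
          have h1 : (4 * Λ) ^ 2 * Real.pi ^ 2 / 8 ≤ 20 * Λ ^ 2 := by nlinarith [sq_nonneg Λ]
          have h2 : Λ ^ 2 * a ≤ Λ / 49 := by nlinarith
          have h3 : Λ ^ 2 * (a * a) ≤ 1 / 2401 := by
            have : 0 ≤ a * Λ := by positivity
            nlinarith
          have hw2 : 0 ≤ ‖w‖ ^ 2 / d := by positivity
          calc _ ≤ 20 * Λ ^ 2 * (a * (1 + a / d * ‖w‖ ^ 2)) := by
                gcongr
                exact hw.2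
            _ = 20 * (Λ ^ 2 * a) + 20 * (Λ ^ 2 * (a * a)) * (‖w‖ ^ 2 / d) := by ring
            _ ≤ 20 * (Λ / 49) + 20 * (1 / 2401) * (‖w‖ ^ 2 / d) := by gcongr
            _ = _ := by ring
      _ ≤ ENNReal.ofReal (Real.exp (20 / 49 * Λ)) *
          ENNReal.ofReal (Real.exp (2 * (20 / 2401))) := by
          rw [lintegral_const_mul' _ _ ENNReal.ofReal_ne_top]
          gcongr
          exact lintegral_exp_norm_sq_stdGaussian_le hd (by norm_num) (by norm_num)
      _ ≤ _ := by
          rw [← ENNReal.ofReal_mul (by positivity), ← Real.exp_add]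
          refine ENNReal.ofReal_le_ofReal (Real.exp_le_exp.2 ?_)
          linarith
  have hexp : Measurable fun p : E d × E d =>
      ENNReal.ofReal (Real.exp (4 * Λ * (g p.2 - g p.1))) := by fun_prop
  calc ∫⁻ p, (ratio g p - 2) ^ 2 ∂((proposal η c).prod (proposal η c))
      ≤ ∫⁻ p, ENNReal.ofReal (4 * Real.exp (-(4 * Λ) * Real.log 2)) *
        ENNReal.ofReal (Real.exp (4 * Λ * (g p.2 - g p.1)))
          ∂((proposal η c).prod (proposal η c)) :=
        lintegral_mono fun p => ratio_sub_two_sq_le g (by linarith) p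
    _ ≤ ENNReal.ofReal (4 * Real.exp (-(4 * Λ) * Real.log 2)) *
        ENNReal.ofReal (Real.exp (Λ / 2)) := by
        rw [lintegral_const_mul' _ _ ENNReal.ofReal_ne_top, lintegral_proposal_prod hη c hexp]
        gcongr
        exact hMP.trans hgauss
    _ ≤ _ := by
        rw [← ENNReal.ofReal_mul (by positivity), ← ENNReal.ofReal_pow (by positivity), mul_pow,
          mul_assoc, ← Real.exp_add, ← Real.exp_nat_mul]
        refine ENNReal.ofReal_le_ofReal ?_
        norm_num
        nlinarith [Real.log_two_gt_d9]

lemma six_mul_le_sq {d n K ζ : ℝ} (hd : 0 < d) (hn : 1 ≤ n) (hζ : 0 < ζ)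
    (hK : K = 192 * n * (d ^ 2 + 2 * d) / ζ ^ 4) :
    6 * (8 * d * (2 * Real.exp (-(2 + Real.log (1 + K))))) ≤ ζ ^ 2 := by
  have hK0 : 192 * d ^ 2 / ζ ^ 4 ≤ K := by
    rw [hK]
    gcongr
    · linarith
    · linarith
  have hK1 : 0 ≤ K := le_trans (by positivity) hK0
  have he : 7 ≤ Real.exp 2 := by
    have h1 := Real.exp_one_gt_d9
    have : Real.exp 2 = Real.exp 1 * Real.exp 1 := by rw [← Real.exp_add]; norm_num
    nlinarith
  have hexp : Real.exp (-(2 + Real.log (1 + K))) = (Real.exp 2 * (1 + K))⁻¹ := by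
    rw [Real.exp_neg, Real.exp_add, Real.exp_log (by linarith)]
  rw [hexp]
  -- After clearing `ζ ^ 2` this is a quadratic inequality in `ζ ^ 2` and `d`, an instance of AM–GM.
  have hmain : 96 * d ≤ ζ ^ 2 * (7 * (1 + 192 * d ^ 2 / ζ ^ 4)) := by
    have : ζ ^ 2 * (7 * (1 + 192 * d ^ 2 / ζ ^ 4)) = 7 * (ζ ^ 4 + 192 * d ^ 2) / ζ ^ 2 := by
      field_simp
    rw [this, le_div_iff₀ (by positivity)]
    nlinarith [sq_nonneg (ζ ^ 2 - 7 * d), sq_nonneg d, sq_nonneg (ζ ^ 2)]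
  have h2 : 96 * d ≤ ζ ^ 2 * (Real.exp 2 * (1 + K)) := hmain.trans (by gcongr)
  calc 6 * (8 * d * (2 * (Real.exp 2 * (1 + K))⁻¹)) = 96 * d / (Real.exp 2 * (1 + K)) := by
        rw [div_eq_mul_inv]; ring
    _ ≤ _ := by rwa [div_le_iff₀ (by positivity)]

end

end RGO

theorem theorem6 :
    ∃ C : ℝ≥0, ∀ (d n : ℕ), 0 < d → 0 < n →
      ∀ (L α : Fin n → ℝ), (∀ j, 0 < L j) → (∀ j, 0 ≤ α j ∧ α j ≤ 1) →
      ∀ (f : Fin n → RGO.E d → ℝ) (f' : Fin n → RGO.E d → RGO.E d),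
        (∀ j, RGO.SemiSmooth (f j) (f' j) (L j) (α j)) →
      ∀ (ζ η : ℝ), 0 < ζ → 0 < η →
        η ≤ min (49 * RGO.compositeConst L α d *
              (2 + Real.log (1 + 192 * n * ((d : ℝ) ^ 2 + 2 * d) / ζ ^ 4)))⁻¹ 1 →
      ∀ (y xy : RGO.E d), (∑ j, f' j xy) + (1 / η) • (xy - y) = 0 →
        (∀ᵐ ω ∂(RGO.drawLaw η xy),
          RGO.Terminates (fun x => ∑ j, f j x) (∑ j, f' j xy) ω) ∧
        RGO.wasserstein2
            (RGO.outputLaw (fun x => ∑ j, f j x) (∑ j, f' j xy) η xy)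
            (RGO.target (fun x => ∑ j, f j x) η y) ≤ ENNReal.ofReal ζ ∧
        (ζ < 2 * √(2 * (d : ℝ)) →
          RGO.expectedQueries (fun x => ∑ j, f j x) (∑ j, f' j xy) η xy ≤ C) := by
  refine ⟨4, fun d n hd hn L α hL hα f f' hf ζ η hζ hη hηle y xy hxy => ?_⟩
  have hlip := RGO.locallyLipschitz_sum hf
  have hmeas : Measurable fun x => ∑ j, f j x := hlip.continuous.measurable
  refine ⟨RGO.ae_terminates _ hη xy hmeas, ?_, fun _ => by
    simpa using RGO.expectedQueries_le _ hη xy hmeas⟩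
  have := RGO.isProbabilityMeasure_proposal hη xy
  rw [RGO.outputLaw_eq _ hη xy hmeas, RGO.target_eq_tilted_proposal _ hη xy y hxy]
  set v := ∑ j, f' j xy with hv
  set K := 192 * n * ((d : ℝ) ^ 2 + 2 * d) / ζ ^ 4 with hK
  have hK0 : 0 ≤ K := by positivity
  set Λ := 2 + Real.log (1 + K) with hΛ
  have hΛ2 : 2 ≤ Λ := by linarith [Real.log_nonneg (show 1 ≤ 1 + K by linarith)]
  have hM : 0 ≤ RGO.compositeConst L α d := sq_nonneg _
  have hstep : 49 * (η * RGO.compositeConst L α d * Λ) ≤ 1 := by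
    calc 49 * (η * RGO.compositeConst L α d * Λ)
        = η * (49 * RGO.compositeConst L α d * Λ) := by ring
      _ ≤ (49 * RGO.compositeConst L α d * Λ)⁻¹ * (49 * RGO.compositeConst L α d * Λ) := by
          gcongr
          exact hηle.trans (min_le_left _ _)
      -- This also holds if the product is zero, so `M ≥ 0` is enough.
      _ ≤ 1 := inv_mul_le_one
  have hinner : LocallyLipschitz fun x : RGO.E d => ⟪v, x⟫ :=
    ContDiff.locallyLipschitz (𝕂 := ℝ) (contDiff_const.inner ℝ contDiff_id)
  have hg : LocallyLipschitz fun x => (∑ j, f j x) - ⟪v, x⟫ := hlip.sub hinner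
  have hbound := RGO.wasserstein2_accepted_tilted_le (RGO.proposal η xy) hg.continuous.measurable xy
    (RGO.lintegral_edist_pow_four_proposal_le hd hη (hηle.trans (min_le_right _ _)) xy)
    (RGO.lintegral_ratio_sub_two_sq_le hd hη xy hg (mul_nonneg hη.le hM) hΛ2 hstep
      (RGO.ae_norm_gradient_sq_le hd hL hα hf hη xy)) ENNReal.ofReal_ne_top
  refine hbound.trans ?_
  rw [← ENNReal.ofReal_mul (by positivity), show (6 : ℝ≥0∞) = ENNReal.ofReal 6 by simp,
    ← ENNReal.ofReal_mul (by positivity)]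
  calc _ ≤ ENNReal.ofReal (ζ ^ 2) ^ (1 / 2 : ℝ) := by
        gcongr
        exact RGO.six_mul_le_sq (by exact_mod_cast hd) (by exact_mod_cast hn) hζ hK
    _ = ENNReal.ofReal ζ := by
        rw [ENNReal.ofReal_rpow_of_nonneg (by positivity) (by norm_num), ← Real.sqrt_eq_rpow,
          Real.sqrt_sq hζ.le]
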